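/- Consider the SISO Rayleigh block-fading channel with one-bit ADCs and coherence time $T\ge 1$: in each block of $T$ channel uses $r=Q(xh+w)$, where $x\in\mathbb{C}^T$ is the input, $h\sim\mathcal{CN}(0,1)$ is the fading coefficient, $w\in\mathbb{C}^T$ has i.i.d. $\mathcal{CN}(0,1)$ entries, $x,h,w$ are independent, $Q$ maps every entry $y_t$ to $\operatorname{sign}(\operatorname{Re}y_t)+j\operatorname{sign}(\operatorname{Im}y_t)$ (with $\operatorname{sign}(0)=1$), and neither transmitter nor receiver knows the realization of $h$. With $\Phi$ the standard normal distribution function and $g\sim\mathcal{N}(0,1)$ put $$\gamma_\rho(a,b)=\mathbb{E}\bigl[\Phi(-g\sqrt{\rho})^a\,\Phi(g\sqrt{\rho})^b\bigr],\qquad R_{\mathrm{QPSK}}(\rho)=2+\frac{2}{T}\sum_{k=0}^{T}\binom{T}{k}\gamma_\rho(k,T-k)\log_2\gamma_\rho(k,T-k).$$ Let $\rho_c>0$ maximize $R_{\mathrm{QPSK}}(\rho)/\rho$ over $\rho>0$. The capacity formula for this channel under the average-power constraint $\mathbb{E}\|x\|^2\le T\rho$ (known from the literature; its derivation is not part of the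 claim) is $$C(\rho)=\begin{cases}\dfrac{\rho}{\rho_c}R_{\mathrm{QPSK}}(\rho_c), & \rho\le\rho_c,\\[1ex] R_{\mathrm{QPSK}}(\rho), & \rho>\rho_c.\end{cases}$$ Least-squares (LS) channel estimation combined with joint pilot-data processing is the following scheme with active power $\rho'>0$ and duty cycle $p\in[0,1]$. With probability $1-p$ a block is silent ($x=0$); with probability $p$ its first symbol is a fixed pilot from the QPSK constellation $\{\sqrt{\rho'/2}\,(\pm1\pm j)\}$ and its other $T-1$ symbols are independent and uniform on that constellation. The $n$th symbol is decoded from $r_n$ and the LS estimate obtained from all past symbols, $\hat h(n-1)=\frac{1}{(n-1)\sqrt{\rho'}}\sum_{i<n}x_i^*r_i$, so that the rate of the scheme, in bits per channel use, is $$R_{\mathrm{JPD}}=\frac1T\sum_{n=2}^{T}I\bigl(x_n;r_n\mid\hat h(n-1)\bigr).$$ Then, for every choice of the pilot: (i) for $p=1$ (plain QPSK signalling) and every active power $\rho>0$ the rate of the scheme is $R_{\mathrm{QPSK}}(\rho)$; (ii) a maximizer $\rho_c$ exists; (iii) for every maximizer $\rho_c$ and every $\rho\ge0$, the scheme with $(\rho',p)=(\rho_c,\rho/\rho_c)$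 if $\rho\le\rho_c$ (on-off QPSK) and $(\rho',p)=(\rho,1)$ if $\rho>\rho_c$ (QPSK) satisfies the power constraint, with $\mathbb{E}\|x\|^2=T\rho$, its rate is achievable, i.e. $R_{\mathrm{JPD}}\le\frac1T I(x;r)$ for its input distribution, and its rate equals the capacity formula: $R_{\mathrm{JPD}}=C(\rho)$. -/

import Mathlib

open MeasureTheory ProbabilityTheory

namespace OneBit

noncomputable section

/-! ### Information measures (in bits) of finitely valued random variables -/

/-- Mutual information `I(X; Y)` in bits, for random variables taking finitely many values. -/
def mutualInfo {Ω α β : Type*} [MeasurableSpace Ω] (μ : Measure Ω)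
    (X : Ω → α) (Y : Ω → β) : ℝ :=
  ∑ᶠ v : α × β,
    μ.real {ω | X ω = v.1 ∧ Y ω = v.2} *
      Real.logb 2 (μ.real {ω | X ω = v.1 ∧ Y ω = v.2} /
        (μ.real {ω | X ω = v.1} * μ.real {ω | Y ω = v.2}))

/-- Conditional mutual information `I(X; Y | Z)` in bits, for random variables taking finitely
many values: the sum of `p(x,y,z) log₂ (p(z) p(x,y,z) / (p(x,z) p(y,z)))`. -/
def condMutualInfo {Ω α β γ : Type*} [MeasurableSpace Ω] (μ : Measure Ω)
    (X : Ω → α) (Y : Ω → β) (Z : Ω → γ) : ℝ :=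
  ∑ᶠ v : α × β × γ,
    μ.real {ω | X ω = v.1 ∧ Y ω = v.2.1 ∧ Z ω = v.2.2} *
      Real.logb 2
        (μ.real {ω | Z ω = v.2.2} * μ.real {ω | X ω = v.1 ∧ Y ω = v.2.1 ∧ Z ω = v.2.2} /
          (μ.real {ω | X ω = v.1 ∧ Z ω = v.2.2} * μ.real {ω | Y ω = v.2.1 ∧ Z ω = v.2.2}))

/-! ### The one-bit quantized Rayleigh block-fading channel -/

/-- The law `CN(0,1)`: independent real and imaginary parts, each `N(0, 1/2)`. -/
def complexGaussian : Measure ℂ :=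
  ((gaussianReal 0 (1 / 2)).prod (gaussianReal 0 (1 / 2))).map (fun v : ℝ × ℝ => ⟨v.1, v.2⟩)

/-- The zero-threshold comparator. -/
def oneBit (y : ℝ) : ℝ := if 0 ≤ y then 1 else -1

/-- The pair of one-bit converters, acting on the real and the imaginary part separately. -/
def quantize (y : ℂ) : ℂ := ⟨oneBit y.re, oneBit y.im⟩

/-- The sample space of one coherence block of length `T`: the input vector, the fading
coefficient and the noise vector. -/
abbrev Block (T : ℕ) : Type := (Fin T → ℂ) × ℂ × (Fin T → ℂ)

/-- The joint law of input, fading and noise when the input vector has law `ν`: the three are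
independent, the fading is `CN(0,1)`, the noise samples are independent and `CN(0,1)`. -/
def blockLaw {T : ℕ} (ν : Measure (Fin T → ℂ)) : Measure (Block T) :=
  ν.prod (complexGaussian.prod (Measure.pi fun _ : Fin T => complexGaussian))

/-- The input vector `x`. -/
def input {T : ℕ} (ω : Block T) : Fin T → ℂ := ω.1

/-- The quantized output vector `r = Q(x h + w)`. -/
def output {T : ℕ} (ω : Block T) : Fin T → ℂ := fun t => quantize (ω.1 t * ω.2.1 + ω.2.2 t)

/-! ### The capacity formula -/

/-- The cumulative distribution function of a standard normal random variable. -/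
def stdNormalCDF (x : ℝ) : ℝ := cdf (gaussianReal 0 1) x

/-- `γ(a,b) = E[Φ(-g √ρ)^a Φ(g √ρ)^b]` with `g` standard normal. -/
def gammaCoeff (ρ : ℝ) (a b : ℕ) : ℝ :=
  ∫ g, stdNormalCDF (-g * √ρ) ^ a * stdNormalCDF (g * √ρ) ^ b ∂(gaussianReal 0 1)

/-- The rate achievable with QPSK, in bits per channel use. -/
def rateQPSK (T : ℕ) (ρ : ℝ) : ℝ :=
  2 + 2 / (T : ℝ) * ∑ k ∈ Finset.range (T + 1),
    (T.choose k : ℝ) * gammaCoeff ρ k (T - k) * Real.logb 2 (gammaCoeff ρ k (T - k))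

/-- `ρc` is an SNR threshold: it maximizes `R_QPSK(ρ) / ρ`. -/
def IsSNRThreshold (T : ℕ) (ρc : ℝ) : Prop :=
  0 < ρc ∧ IsMaxOn (fun ρ : ℝ => 1 / ρ * rateQPSK T ρ) (Set.Ioi 0) ρc

/-- The capacity formula with threshold `ρc`. -/
def capacity (T : ℕ) (ρc snr : ℝ) : ℝ :=
  if snr ≤ ρc then snr / ρc * rateQPSK T ρc else rateQPSK T snr

/-! ### LS estimation with joint pilot-data processing -/

/-- The QPSK constellation with symbols of power `ρ`. -/
def qpsk (ρ : ℝ) : Set ℂ :=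
  {z | ∃ a ∈ ({1, -1} : Set ℝ), ∃ b ∈ ({1, -1} : Set ℝ), z = (√(ρ / 2) : ℂ) * (⟨a, b⟩ : ℂ)}

/-- The words whose first symbol is the given pilot and whose other symbols are QPSK symbols. -/
def pilotWords (T : ℕ) (ρ : ℝ) (pilot : ℂ) : Set (Fin T → ℂ) :=
  {x | ∀ n : Fin T, if (n : ℕ) = 0 then x n = pilot else x n ∈ qpsk ρ}

/-- The on-off QPSK input law with duty cycle `p`: with probability `1 - p` the block is
silent; with probability `p` it consists of the pilot followed by independent, uniformly
distributed QPSK symbols of power `ρ`. For `p = 1` this is plain QPSK signalling. -/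
def onOffInput (T : ℕ) (ρ p : ℝ) (pilot : ℂ) : Measure (Fin T → ℂ) :=
  ENNReal.ofReal (1 - p) • Measure.dirac 0 +
    ENNReal.ofReal p • uniformOn (pilotWords T ρ pilot)

/-- The LS channel estimate `(P √ρ)⁻¹ ∑ conj(x_i) r_i` from the `P = n` symbols that precede
the symbol with (zero-based) index `n`. -/
def lsEstimate {T : ℕ} (ρ : ℝ) (n : Fin T) (ω : Block T) : ℂ :=
  1 / (((n : ℕ) : ℂ) * (√ρ : ℂ)) *
    ∑ i ∈ Finset.univ.filter (fun i : Fin T => i < n), star (input ω i) * output ω i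

/-- The rate, in bits per channel use, of the scheme which sends one pilot and then decodes
each symbol with the LS estimate obtained from all past symbols of the block. -/
def jpdRate (T : ℕ) (ρ p : ℝ) (pilot : ℂ) : ℝ :=
  1 / (T : ℝ) * ∑ n ∈ Finset.univ.filter (fun n : Fin T => 1 ≤ (n : ℕ)),
    condMutualInfo (blockLaw (onOffInput T ρ p pilot))
      (fun ω => input ω n) (fun ω => output ω n) (lsEstimate ρ n)

/-- The power of the active symbols: on-off signalling at power `ρc` up to the threshold, plain
QPSK above it. -/
def activePower (ρc snr : ℝ) : ℝ := if snr ≤ ρc then ρc else snr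

/-- The fraction of active blocks. -/
def dutyCycle (ρc snr : ℝ) : ℝ := if snr ≤ ρc then snr / ρc else 1

end

end OneBit

/-! The transmitted QPSK symbol only rotates the received letter: if `x_t = √ρ e^{jπ/4} j^k`, then
`r_t = j^k s_t`, where, by the circular symmetry of fading and noise, the law of the word `s` does
not depend on the symbols. Real and imaginary parts of `s` are independent, and given the fading each
consists of independent signs, so that the probability of `s` is a product of two coefficients `γ`
(`channelLaw_real_output_symbol`, `wordProb_eq_gammaCoeff`). Hence input and output of an on-off
block have an explicit finite joint law (`blockLaw_real`), and all information measures are finite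
sums.

The least-squares estimate is a multiple of `∑ s_i`. As the probability of a word depends only on
its numbers of signs, this sum is a sufficient statistic: the conditional law of `s_n` given the
estimate is the one given `s_1, …, s_{n-1}` (`sum_mul_wordProb_eq`). The letter `r_n` alone is uniform
and independent of the estimate. In a silent block `r_n` is uniform too, so silence carries no
information even though the estimate may be zero in an active block as well. So a symbol
contributes `p (2 - H(s_n | s_1, …, s_{n-1}))` bits, with `H` the entropy
(`condMutualInfo_lsEstimate`), and the chain rule turns the sum over `n` into `p (2T - H(s))`, which
is `T p R_QPSK(ρ)` (`jpdRate_eq`). Since the output word is uniform for every duty cycle, `I(x; r)`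
has the same value (`mutualInfo_eq`), which gives achievability.

For the threshold, `R_QPSK` is a divergence from the uniform law, hence nonnegative, and is bounded by
two. It is dominated by a chi-squared distance, and `γ_ρ(a, b) - 2^{-(a+b)} = O(ρ)` because the term
of order `√ρ` is odd in `g`; so `R_QPSK(ρ) = O(ρ²)`. Thus `R_QPSK(ρ)/ρ` is continuous and tends to zero
at both ends of `(0, ∞)`, and has a maximizer (`exists_isSNRThreshold`). -/

namespace OneBit

/-! ### The standard normal distribution function -/

lemma stdNormalCDF_eq_real (x : ℝ) :
    stdNormalCDF x = (gaussianReal 0 1).real (Set.Iic x) := cdf_eq_real _ _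

lemma stdNormalCDF_nonneg (x : ℝ) : 0 ≤ stdNormalCDF x := cdf_nonneg _ _

lemma stdNormalCDF_le_one (x : ℝ) : stdNormalCDF x ≤ 1 := cdf_le_one _ _

lemma stdNormalCDF_pos (x : ℝ) : 0 < stdNormalCDF x := by
  rw [stdNormalCDF_eq_real, measureReal_def, ENNReal.toReal_pos_iff]
  refine ⟨pos_iff_ne_zero.2 fun h => ?_, measure_lt_top _ _⟩
  have := gaussianReal_absolutelyContinuous' 0 one_ne_zero h
  simp at this

lemma stdNormalCDF_add_neg (x : ℝ) : stdNormalCDF x + stdNormalCDF (-x) = 1 := by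
  have : NullSingletonClass (gaussianReal 0 1) := nullSingletonClass_gaussianReal one_ne_zero
  have h : (gaussianReal 0 1).real (Set.Iic (-x)) = (gaussianReal 0 1).real (Set.Ioi x) := by
    conv_lhs => rw [← neg_zero, ← gaussianReal_map_neg]
    rw [map_measureReal_apply measurable_neg measurableSet_Iic, measureReal_congr Ioi_ae_eq_Ici]
    congr 1
    ext y
    simp
  rw [stdNormalCDF_eq_real, stdNormalCDF_eq_real, h, ← Set.compl_Iic]
  exact probReal_add_probReal_compl measurableSet_Iic

lemma stdNormalCDF_zero : stdNormalCDF 0 = 1 / 2 := by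
  have := stdNormalCDF_add_neg 0
  rw [neg_zero] at this
  linarith

lemma stdNormalCDF_mono : Monotone stdNormalCDF := monotone_cdf _

/-- The standard normal density is bounded by one, so its primitive is 1-Lipschitz. -/
lemma stdNormalCDF_sub_le {x y : ℝ} (h : x ≤ y) : stdNormalCDF y - stdNormalCDF x ≤ y - x := by
  have h1 : stdNormalCDF y - stdNormalCDF x = (gaussianReal 0 1).real (Set.Ioc x y) := by
    rw [stdNormalCDF_eq_real, stdNormalCDF_eq_real, ← Set.Iic_union_Ioc_eq_Iic h,
      measureReal_union (Set.Iic_disjoint_Ioc le_rfl) measurableSet_Ioc]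
    ring
  have h2 : ∀ t, gaussianPDFReal 0 1 t ≤ 1 := by
    intro t
    rw [gaussianPDFReal_def]
    have hs : (1 : ℝ) ≤ √(2 * Real.pi * 1) := by
      rw [Real.one_le_sqrt]
      linarith [Real.pi_gt_three]
    have he : Real.exp (-(t - 0) ^ 2 / (2 * 1)) ≤ 1 := by
      rw [Real.exp_le_one_iff]
      nlinarith [sq_nonneg (t - 0)]
    exact mul_le_one₀ (inv_le_one_of_one_le₀ hs) (Real.exp_pos _).le he
  rw [h1, measureReal_def, gaussianReal_apply_eq_integral 0 one_ne_zero]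
  refine ENNReal.toReal_le_of_le_ofReal (sub_nonneg.2 h) (ENNReal.ofReal_le_ofReal ?_)
  have := norm_setIntegral_le_of_norm_le_const (μ := volume) (s := Set.Ioc x y)
    measure_Ioc_lt_top (f := gaussianPDFReal 0 1) (C := 1) fun t _ => by
      rw [Real.norm_of_nonneg (gaussianPDFReal_nonneg 0 1 t)]
      exact h2 t
  rw [one_mul, Real.volume_real_Ioc_of_le h] at this
  exact (le_abs_self _).trans this

lemma abs_stdNormalCDF_sub_half_le (x : ℝ) : |stdNormalCDF x - 1 / 2| ≤ |x| := by
  rw [← stdNormalCDF_zero]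
  rcases le_total 0 x with h | h
  · rw [abs_of_nonneg (sub_nonneg.2 (stdNormalCDF_mono h)), abs_of_nonneg h]
    simpa using stdNormalCDF_sub_le h
  · rw [abs_of_nonpos (sub_nonpos.2 (stdNormalCDF_mono h)), abs_of_nonpos h]
    simpa using stdNormalCDF_sub_le h

@[fun_prop]
lemma continuous_stdNormalCDF : Continuous stdNormalCDF := by
  refine (LipschitzWith.of_dist_le_mul (K := 1) fun x y => ?_).continuous
  rw [NNReal.coe_one, one_mul, Real.dist_eq, Real.dist_eq]
  rcases le_total x y with h | h
  · rw [abs_sub_comm, abs_of_nonneg (sub_nonneg.2 (stdNormalCDF_mono h)), abs_sub_comm,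
      abs_of_nonneg (sub_nonneg.2 h)]
    exact stdNormalCDF_sub_le h
  · rw [abs_of_nonneg (sub_nonneg.2 (stdNormalCDF_mono h)), abs_of_nonneg (sub_nonneg.2 h)]
    exact stdNormalCDF_sub_le h

@[fun_prop]
lemma measurable_stdNormalCDF : Measurable stdNormalCDF := continuous_stdNormalCDF.measurable

/-! ### One use of the channel -/

/-- The sign encoded by a bit. -/
def sgn (b : Bool) : ℝ := if b then 1 else -1

@[simp] lemma sgn_true : sgn true = 1 := rfl

@[simp] lemma sgn_false : sgn false = -1 := rfl

/-- The output letter `±1 ± j` encoded by a pair of bits. -/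
def letter (s : Bool × Bool) : ℂ := ⟨sgn s.1, sgn s.2⟩

lemma sgn_injective : Function.Injective sgn := by
  rintro (_ | _) (_ | _) h <;> simp at h ⊢ <;> norm_num at h

lemma letter_injective : Function.Injective letter := by
  rintro ⟨a, b⟩ ⟨c, d⟩ h
  rw [letter, letter, Complex.mk.injEq] at h
  exact Prod.ext (sgn_injective h.1) (sgn_injective h.2)

lemma exists_oneBit_eq_sgn (y : ℝ) : ∃ b, oneBit y = sgn b := by
  rcases le_or_gt 0 y with h | h
  · exact ⟨true, by simp [oneBit, h]⟩
  · exact ⟨false, by simp [oneBit, not_le.2 h]⟩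

lemma exists_quantize_eq_letter (y : ℂ) : ∃ s, quantize y = letter s := by
  obtain ⟨a, ha⟩ := exists_oneBit_eq_sgn y.re
  obtain ⟨b, hb⟩ := exists_oneBit_eq_sgn y.im
  exact ⟨(a, b), by rw [quantize, ha, hb, letter]⟩

@[fun_prop]
lemma measurable_oneBit : Measurable oneBit :=
  Measurable.ite measurableSet_Ici measurable_const measurable_const

lemma measurable_complex_mk : Measurable fun v : ℝ × ℝ => (⟨v.1, v.2⟩ : ℂ) :=
  Complex.measurableEquivRealProd.symm.measurable

@[fun_prop]
lemma measurable_quantize : Measurable quantize :=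
  measurable_complex_mk.comp
    ((measurable_oneBit.comp Complex.measurable_re).prodMk
      (measurable_oneBit.comp Complex.measurable_im))

instance : IsProbabilityMeasure complexGaussian :=
  Measure.isProbabilityMeasure_map measurable_complex_mk.aemeasurable

lemma gaussianReal_half_eq_map :
    gaussianReal 0 (1 / 2) = (gaussianReal 0 1).map (fun x => x / √2) := by
  rw [gaussianReal_map_div_const, zero_div]
  congr 1
  ext
  simp

/-- The law of a one-bit sample of `y` plus noise of variance `1/2`. -/
lemma real_oneBit_eq_sgn (y : ℝ) (b : Bool) :
    (gaussianReal 0 (1 / 2)).real {w | oneBit (y + w) = sgn b} = stdNormalCDF (sgn b * (√2 * y)) := by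
  have h2 : (0 : ℝ) < √2 := by positivity
  have hf : (gaussianReal 0 (1 / 2)).real {w | oneBit (y + w) = sgn false} =
      stdNormalCDF (-(√2 * y)) := by
    have : NullSingletonClass (gaussianReal 0 1) := nullSingletonClass_gaussianReal one_ne_zero
    have hm : MeasurableSet {w | oneBit (y + w) = sgn false} :=
      measurableSet_eq_fun (by fun_prop) measurable_const
    rw [gaussianReal_half_eq_map, map_measureReal_apply (by fun_prop) hm, stdNormalCDF_eq_real,
      ← measureReal_congr Iio_ae_eq_Iic]
    congr 1
    ext w
    have : oneBit (y + w / √2) = sgn false ↔ y + w / √2 < 0 := by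
      unfold oneBit
      split_ifs with h
      · norm_num; exact h
      · simpa using h
    rw [Set.mem_preimage, Set.mem_ofPred_eq, this, Set.mem_Iio,
      ← mul_lt_mul_iff_right₀ h2, mul_add, mul_div_cancel₀ _ h2.ne', mul_zero]
    constructor <;> intro h <;> linarith
  cases b with
  | false => simpa using hf
  | true =>
    have hc : {w | oneBit (y + w) = sgn true} = {w | oneBit (y + w) = sgn false}ᶜ := by
      ext w
      obtain ⟨b, hb⟩ := exists_oneBit_eq_sgn (y + w)
      simp only [Set.mem_ofPred_eq, Set.mem_compl_iff, hb, sgn_injective.eq_iff]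
      cases b <;> simp
    rw [hc, probReal_compl_eq_one_sub (measurableSet_eq_fun (by fun_prop) measurable_const), hf]
    have := stdNormalCDF_add_neg (√2 * y)
    simp only [sgn_true, one_mul]
    linarith

/-- The conditional law of one output letter, given the noise-free received value `y`. -/
lemma real_quantize_eq_letter (y : ℂ) (s : Bool × Bool) :
    complexGaussian.real {w | quantize (y + w) = letter s} =
      stdNormalCDF (sgn s.1 * (√2 * y.re)) * stdNormalCDF (sgn s.2 * (√2 * y.im)) := by
  have hm : MeasurableSet {w | quantize (y + w) = letter s} :=
    measurableSet_eq_fun (by fun_prop) measurable_const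
  rw [complexGaussian, map_measureReal_apply measurable_complex_mk hm, ← real_oneBit_eq_sgn,
    ← real_oneBit_eq_sgn, ← measureReal_prod_prod]
  congr 1
  ext v
  simp [quantize, letter]

/-- Up to a rotation by `45` degrees, the real and imaginary parts of the fading coefficient are
independent standard normal variables. -/
lemma map_complexGaussian :
    complexGaussian.map (fun h : ℂ => (h.re - h.im, h.re + h.im)) =
      (gaussianReal 0 1).prod (gaussianReal 0 1) := by
  have hrot := IsGaussian.map_rotation_eq_self_of_forall_strongDual_eq_zero
    (μ := gaussianReal 0 1) (fun L => by
      rw [integral_continuousLinearMap_gaussianReal L]; simp) (-(Real.pi / 4))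
  rw [complexGaussian, Measure.map_map (by fun_prop) measurable_complex_mk,
    gaussianReal_half_eq_map, Measure.map_prod_map _ _ (by fun_prop) (by fun_prop),
    Measure.map_map (Measurable.comp (by fun_prop) measurable_complex_mk) (by fun_prop)]
  conv_rhs => rw [← hrot]
  congr 1
  ext v
  · have h2 : (√2 : ℝ) ^ 2 = 2 := Real.sq_sqrt (by norm_num)
    simp [ContinuousLinearMap.rotation_apply]
    field_simp
    rw [h2]
    ring
  · have h2 : (√2 : ℝ) ^ 2 = 2 := Real.sq_sqrt (by norm_num)
    simp [ContinuousLinearMap.rotation_apply]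
    field_simp
    rw [h2]
    ring

/-! ### The coefficients `γ` -/

lemma stdNormalCDF_neg (x : ℝ) : stdNormalCDF (-x) = 1 - stdNormalCDF x := by
  linarith [stdNormalCDF_add_neg x]

lemma gammaCoeff_integrand_mem (a b : ℕ) (x y : ℝ) :
    0 ≤ stdNormalCDF x ^ a * stdNormalCDF y ^ b ∧ stdNormalCDF x ^ a * stdNormalCDF y ^ b ≤ 1 :=
  ⟨mul_nonneg (pow_nonneg (stdNormalCDF_nonneg _) _) (pow_nonneg (stdNormalCDF_nonneg _) _),
    mul_le_one₀ (pow_le_one₀ (stdNormalCDF_nonneg _) (stdNormalCDF_le_one _))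
      (pow_nonneg (stdNormalCDF_nonneg _) _)
      (pow_le_one₀ (stdNormalCDF_nonneg _) (stdNormalCDF_le_one _))⟩

lemma integrable_gammaCoeff_integrand (ρ : ℝ) (a b : ℕ) :
    Integrable (fun g => stdNormalCDF (-g * √ρ) ^ a * stdNormalCDF (g * √ρ) ^ b)
      (gaussianReal 0 1) := by
  refine Integrable.of_bound (by fun_prop) 1 (.of_forall fun g => ?_)
  have := gammaCoeff_integrand_mem a b (-g * √ρ) (g * √ρ)
  rw [Real.norm_of_nonneg this.1]
  exact this.2

lemma gammaCoeff_pos (ρ : ℝ) (a b : ℕ) : 0 < gammaCoeff ρ a b := by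
  refine (integral_pos_iff_support_of_nonneg
    (fun g => (gammaCoeff_integrand_mem a b _ _).1) (integrable_gammaCoeff_integrand ρ a b)).2 ?_
  have : (Function.support fun g => stdNormalCDF (-g * √ρ) ^ a * stdNormalCDF (g * √ρ) ^ b) =
      Set.univ := Set.eq_univ_of_forall fun g =>
    (mul_pos (pow_pos (stdNormalCDF_pos _) _) (pow_pos (stdNormalCDF_pos _) _)).ne'
  rw [this, measure_univ]
  exact one_pos

lemma gammaCoeff_le_one (ρ : ℝ) (a b : ℕ) : gammaCoeff ρ a b ≤ 1 := by
  have := integral_mono (integrable_gammaCoeff_integrand ρ a b) (integrable_const 1)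
    fun g => (gammaCoeff_integrand_mem a b _ _).2
  rwa [integral_const, probReal_univ, one_smul] at this

lemma continuous_gammaCoeff (a b : ℕ) : Continuous fun ρ => gammaCoeff ρ a b := by
  refine continuous_of_dominated (bound := fun _ => 1) (fun ρ => by fun_prop) (fun ρ => ?_)
    (integrable_const _) (.of_forall fun g => by fun_prop)
  refine .of_forall fun g => ?_
  have := gammaCoeff_integrand_mem a b (-g * √ρ) (g * √ρ)
  rw [Real.norm_of_nonneg this.1]
  exact this.2

lemma sum_choose_mul_gammaCoeff (T : ℕ) (ρ : ℝ) :
    ∑ k ∈ Finset.range (T + 1), (T.choose k : ℝ) * gammaCoeff ρ k (T - k) = 1 := by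
  simp only [gammaCoeff, ← integral_const_mul]
  rw [← integral_finsetSum _ fun k _ => (integrable_gammaCoeff_integrand ρ k (T - k)).const_mul _]
  have : ∀ g : ℝ, ∑ k ∈ Finset.range (T + 1),
      (T.choose k : ℝ) * (stdNormalCDF (-g * √ρ) ^ k * stdNormalCDF (g * √ρ) ^ (T - k)) = 1 := by
    intro g
    have h := add_pow (stdNormalCDF (-g * √ρ)) (stdNormalCDF (g * √ρ)) T
    rw [neg_mul, add_comm (stdNormalCDF (-(g * √ρ))), stdNormalCDF_add_neg, one_pow] at h
    rw [h, neg_mul]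
    exact Finset.sum_congr rfl fun k _ => by ring
  simp only [this, integral_const, probReal_univ, one_smul]

/-- First-order Taylor expansion of `(1/2 - u)^a (1/2 + u)^b` at `0`; the remainder is `u²` times a
polynomial, which is bounded on `[-1/2, 1/2]`. -/
lemma exists_expansion (a b : ℕ) : ∃ c K : ℝ, ∀ u : ℝ, |u| ≤ 1 / 2 →
    |(1 / 2 - u) ^ a * (1 / 2 + u) ^ b - (1 / 2) ^ (a + b) - c * u| ≤ K * u ^ 2 := by
  open Polynomial in
  let P : ℝ[X] := (C (1 / 2) - X) ^ a * (C (1 / 2) + X) ^ b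
  obtain ⟨K, hK⟩ := (isCompact_Icc (a := -(1 / 2 : ℝ)) (b := 1 / 2)).exists_bound_of_continuousOn
    (P.divX.divX).continuous.continuousOn
  refine ⟨P.divX.coeff 0, K, fun u hu => ?_⟩
  have h1 := congrArg (Polynomial.eval u) P.divX_mul_X_add
  have h2 := congrArg (Polynomial.eval u) P.divX.divX_mul_X_add
  have h0 : P.coeff 0 = (1 / 2) ^ (a + b) := by
    rw [Polynomial.coeff_zero_eq_eval_zero]
    simp [P, pow_add]
  have hP : P.eval u = (1 / 2 - u) ^ a * (1 / 2 + u) ^ b := by simp [P]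
  simp only [Polynomial.eval_add, Polynomial.eval_mul, Polynomial.eval_X, Polynomial.eval_C] at h1 h2
  rw [← hP, ← h0, ← h1, ← h2]
  have : (Polynomial.eval u P.divX.divX * u + P.divX.coeff 0) * u + P.coeff 0 - P.coeff 0
      - P.divX.coeff 0 * u = Polynomial.eval u P.divX.divX * u ^ 2 := by ring
  rw [this, abs_mul, abs_of_nonneg (sq_nonneg u)]
  exact mul_le_mul_of_nonneg_right (hK u (abs_le.1 hu)) (sq_nonneg u)

lemma integral_sq_gaussianReal : ∫ g, g ^ 2 ∂(gaussianReal 0 1) = 1 := by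
  have h := variance_fun_id_gaussianReal (μ := 0) (v := 1)
  rw [variance_of_integral_eq_zero (by fun_prop) integral_id_gaussianReal] at h
  simpa using h

/-- The coefficients depart from their value at zero SNR at most linearly in the SNR: the term of
order `√ρ` in the expansion vanishes because `Φ - 1/2` is odd. -/
lemma exists_abs_gammaCoeff_sub_le (a b : ℕ) :
    ∃ K : ℝ, ∀ ρ : ℝ, 0 ≤ ρ → |gammaCoeff ρ a b - (1 / 2) ^ (a + b)| ≤ K * ρ := by
  obtain ⟨c, K, hK⟩ := exists_expansion a b
  refine ⟨K, fun ρ hρ => ?_⟩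
  have hK0 : 0 ≤ K := by
    have := (abs_nonneg _).trans (hK (1 / 2) (by norm_num))
    norm_num at this
    exact this
  set u : ℝ → ℝ := fun g => stdNormalCDF (g * √ρ) - 1 / 2 with hu
  have hu_odd : ∀ g, u (-g) = -u g := by
    intro g
    simp only [hu, neg_mul, stdNormalCDF_neg]
    ring
  have hu_half : ∀ g, |u g| ≤ 1 / 2 := by
    intro g
    rw [abs_le]
    constructor <;> simp only [hu] <;>
      linarith [stdNormalCDF_nonneg (g * √ρ), stdNormalCDF_le_one (g * √ρ)]
  have hu_int : Integrable u (gaussianReal 0 1) :=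
    Integrable.of_bound (by fun_prop) (1 / 2) (.of_forall hu_half)
  have hu_zero : ∫ g, u g ∂(gaussianReal 0 1) = 0 := by
    have h1 : ∫ g, u g ∂(gaussianReal 0 1) = ∫ g, u (-g) ∂(gaussianReal 0 1) := by
      conv_lhs => rw [← neg_zero, ← gaussianReal_map_neg]
      rw [integral_map (by fun_prop) (by fun_prop)]
    simp only [hu_odd, integral_neg] at h1
    linarith
  have hu_sq : ∀ g, u g ^ 2 ≤ ρ * g ^ 2 := by
    intro g
    have := sq_le_sq.2 (abs_stdNormalCDF_sub_half_le (g * √ρ))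
    rwa [mul_pow, Real.sq_sqrt hρ, mul_comm (g ^ 2)] at this
  have hsq_int : Integrable (fun g : ℝ => g ^ 2) (gaussianReal 0 1) :=
    (memLp_id_gaussianReal 2).integrable_sq
  have hγ : gammaCoeff ρ a b - (1 / 2) ^ (a + b) = ∫ g,
      (stdNormalCDF (-g * √ρ) ^ a * stdNormalCDF (g * √ρ) ^ b - (1 / 2) ^ (a + b) - c * u g)
        ∂(gaussianReal 0 1) := by
    rw [integral_sub (by
      exact (integrable_gammaCoeff_integrand ρ a b).sub (integrable_const _)) (hu_int.const_mul c),
      integral_sub (integrable_gammaCoeff_integrand ρ a b)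
      (integrable_const _), integral_const_mul, hu_zero]
    simp [gammaCoeff]
  rw [hγ]
  have hb := norm_integral_le_of_norm_le ((hsq_int.const_mul ρ).const_mul K)
    (f := fun g => stdNormalCDF (-g * √ρ) ^ a * stdNormalCDF (g * √ρ) ^ b -
      (1 / 2) ^ (a + b) - c * u g) (.of_forall fun g => by
    have h := hK (u g) (hu_half g)
    rw [show 1 / 2 - u g = stdNormalCDF (-g * √ρ) by
      simp only [hu, neg_mul, stdNormalCDF_neg]; ring,
      show 1 / 2 + u g = stdNormalCDF (g * √ρ) by simp only [hu]; ring] at h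
    exact h.trans (mul_le_mul_of_nonneg_left (hu_sq g) hK0))
  rwa [integral_const_mul, integral_const_mul, integral_sq_gaussianReal, mul_one] at hb

/-! ### Existence of the SNR threshold -/

/-- The QPSK rate as a divergence between the output distribution and the uniform one. -/
lemma rateQPSK_eq_divergence {T : ℕ} (hT : 1 ≤ T) (ρ : ℝ) :
    rateQPSK T ρ = 2 / (T : ℝ) * ∑ k ∈ Finset.range (T + 1), (T.choose k : ℝ) *
      (gammaCoeff ρ k (T - k) * Real.logb 2 (2 ^ T * gammaCoeff ρ k (T - k))) := by
  have hT' : (T : ℝ) ≠ 0 := by positivity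
  have h : ∀ k, (T.choose k : ℝ) *
      (gammaCoeff ρ k (T - k) * Real.logb 2 (2 ^ T * gammaCoeff ρ k (T - k))) =
      (T.choose k : ℝ) * gammaCoeff ρ k (T - k) * T +
        (T.choose k : ℝ) * gammaCoeff ρ k (T - k) * Real.logb 2 (gammaCoeff ρ k (T - k)) := by
    intro k
    rw [Real.logb_mul (by positivity) (gammaCoeff_pos _ _ _).ne', Real.logb_pow,
      Real.logb_self_eq_one (by norm_num)]
    ring
  simp only [h, Finset.sum_add_distrib, ← Finset.sum_mul, sum_choose_mul_gammaCoeff]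
  rw [rateQPSK]
  field_simp

lemma rateQPSK_le_two (T : ℕ) (ρ : ℝ) : rateQPSK T ρ ≤ 2 := by
  have : ∑ k ∈ Finset.range (T + 1),
      (T.choose k : ℝ) * gammaCoeff ρ k (T - k) * Real.logb 2 (gammaCoeff ρ k (T - k)) ≤ 0 :=
    Finset.sum_nonpos fun k _ => mul_nonpos_of_nonneg_of_nonpos
      (mul_nonneg (Nat.cast_nonneg _) (gammaCoeff_pos _ _ _).le)
      (Real.logb_nonpos (by norm_num) (gammaCoeff_pos _ _ _).le (gammaCoeff_le_one _ _ _))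
  rw [rateQPSK]
  nlinarith [show (0 : ℝ) ≤ 2 / T by positivity]

lemma sum_choose_mul_half_pow (T : ℕ) :
    ∑ k ∈ Finset.range (T + 1), (T.choose k : ℝ) * (1 / 2) ^ T = 1 := by
  have h : ∑ k ∈ Finset.range (T + 1), (T.choose k : ℝ) = 2 ^ T := by
    exact_mod_cast Nat.sum_range_choose T
  rw [← Finset.sum_mul, h, ← mul_pow]
  norm_num

lemma rateQPSK_nonneg {T : ℕ} (hT : 1 ≤ T) (ρ : ℝ) : 0 ≤ rateQPSK T ρ := by
  rw [rateQPSK_eq_divergence hT]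
  refine mul_nonneg (by positivity) ?_
  have hl : (0 : ℝ) < Real.log 2 := Real.log_pos (by norm_num)
  have h : ∀ k ∈ Finset.range (T + 1),
      ((T.choose k : ℝ) * gammaCoeff ρ k (T - k) - (T.choose k : ℝ) * (1 / 2) ^ T) / Real.log 2 ≤
      (T.choose k : ℝ) *
        (gammaCoeff ρ k (T - k) * Real.logb 2 (2 ^ T * gammaCoeff ρ k (T - k))) := by
    intro k _
    have hγ := gammaCoeff_pos ρ k (T - k)
    have := Real.one_sub_inv_le_log_of_pos (show 0 < 2 ^ T * gammaCoeff ρ k (T - k) by positivity)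
    rw [← mul_sub, mul_div_assoc]
    refine mul_le_mul_of_nonneg_left ?_ (Nat.cast_nonneg _)
    rw [Real.logb, ← mul_div_assoc]
    refine div_le_div_of_nonneg_right ?_ hl.le
    calc gammaCoeff ρ k (T - k) - (1 / 2) ^ T
        = gammaCoeff ρ k (T - k) * (1 - (2 ^ T * gammaCoeff ρ k (T - k))⁻¹) := by
          field_simp
          rw [sub_mul, ← mul_pow]
          norm_num
      _ ≤ _ := by gcongr
  refine le_trans ?_ (Finset.sum_le_sum h)
  rw [← Finset.sum_div, Finset.sum_sub_distrib, sum_choose_mul_gammaCoeff,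
    sum_choose_mul_half_pow]
  simp

/-- At low SNR the QPSK rate vanishes quadratically: the divergence from the uniform distribution
is at most the chi-squared distance. -/
lemma exists_rateQPSK_le_sq {T : ℕ} (hT : 1 ≤ T) :
    ∃ A : ℝ, ∀ ρ : ℝ, 0 ≤ ρ → rateQPSK T ρ ≤ A * ρ ^ 2 := by
  choose K hK using fun k : ℕ => exists_abs_gammaCoeff_sub_le k (T - k)
  refine ⟨2 / (T : ℝ) * (∑ k ∈ Finset.range (T + 1), (T.choose k : ℝ) * (2 ^ T * K k ^ 2)) /
    Real.log 2, fun ρ hρ => ?_⟩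
  have hl : (0 : ℝ) < Real.log 2 := Real.log_pos (by norm_num)
  rw [rateQPSK_eq_divergence hT, mul_div_assoc, mul_assoc]
  refine mul_le_mul_of_nonneg_left ?_ (by positivity)
  have h : ∀ k ∈ Finset.range (T + 1), (T.choose k : ℝ) *
      (gammaCoeff ρ k (T - k) * Real.logb 2 (2 ^ T * gammaCoeff ρ k (T - k))) ≤
      ((T.choose k : ℝ) * (2 ^ T * K k ^ 2) * ρ ^ 2 + ((T.choose k : ℝ) * gammaCoeff ρ k (T - k) -
        (T.choose k : ℝ) * (1 / 2) ^ T)) / Real.log 2 := by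
    intro k hk
    have hγ := gammaCoeff_pos ρ k (T - k)
    have hlog := Real.log_le_sub_one_of_pos
      (show 0 < 2 ^ T * gammaCoeff ρ k (T - k) by positivity)
    have hk' := hK k ρ hρ
    rw [Nat.add_sub_cancel' (Finset.mem_range_succ_iff.1 hk)] at hk'
    have hsq : (gammaCoeff ρ k (T - k) - (1 / 2) ^ T) ^ 2 ≤ (K k * ρ) ^ 2 :=
      sq_le_sq.2 (hk'.trans (le_abs_self _))
    have h2 : (2 : ℝ) ^ T * (1 / 2) ^ T = 1 := by rw [← mul_pow]; norm_num
    rw [mul_assoc, ← mul_sub, ← mul_add, mul_div_assoc, Real.logb, ← mul_div_assoc]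
    gcongr
    calc gammaCoeff ρ k (T - k) * Real.log (2 ^ T * gammaCoeff ρ k (T - k))
        ≤ gammaCoeff ρ k (T - k) * (2 ^ T * gammaCoeff ρ k (T - k) - 1) := by gcongr
      _ = 2 ^ T * (gammaCoeff ρ k (T - k) - (1 / 2) ^ T) ^ 2 +
          (gammaCoeff ρ k (T - k) - (1 / 2) ^ T) := by
          linear_combination (2 * gammaCoeff ρ k (T - k) - (1 / 2) ^ T) * h2
      _ ≤ 2 ^ T * (K k * ρ) ^ 2 + (gammaCoeff ρ k (T - k) - (1 / 2) ^ T) := by gcongr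
      _ = _ := by ring
  refine (Finset.sum_le_sum h).trans_eq ?_
  rw [← Finset.sum_div, Finset.sum_add_distrib, Finset.sum_sub_distrib, sum_choose_mul_gammaCoeff,
    sum_choose_mul_half_pow, ← Finset.sum_mul]
  ring

lemma continuous_rateQPSK (T : ℕ) : Continuous fun ρ => rateQPSK T ρ := by
  have := continuous_gammaCoeff
  unfold rateQPSK
  refine continuous_const.add (continuous_const.mul (continuous_finsetSum _ fun k _ => ?_))
  refine (continuous_const.mul (this _ _)).mul ?_
  exact ((this _ _).log fun ρ => (gammaCoeff_pos _ _ _).ne').div_const _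

/-- The rate per unit of power is continuous and nonnegative, and vanishes both at low SNR, where
the rate is quadratic, and at high SNR, where it is bounded. -/
lemma exists_isSNRThreshold {T : ℕ} (hT : 1 ≤ T) : ∃ ρc, IsSNRThreshold T ρc := by
  obtain ⟨A, hA⟩ := exists_rateQPSK_le_sq hT
  set f : ℝ → ℝ := fun ρ => 1 / ρ * rateQPSK T ρ with hf
  by_cases hpos : ∃ ρ₁ > 0, 0 < f ρ₁
  swap
  · push Not at hpos
    refine ⟨1, one_pos, fun ρ hρ => (hpos ρ hρ).trans ?_⟩
    simpa using rateQPSK_nonneg hT 1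
  obtain ⟨ρ₁, hρ₁, hv⟩ := hpos
  have hA0 : 0 ≤ A := by simpa using (rateQPSK_nonneg hT 1).trans (hA 1 zero_le_one)
  have hlow : ∀ ρ, 0 < ρ → f ρ ≤ A * ρ := by
    intro ρ hρ
    rw [show f ρ = 1 / ρ * rateQPSK T ρ from rfl, one_div_mul_eq_div, div_le_iff₀ hρ]
    linarith [hA ρ hρ.le]
  have hhigh : ∀ ρ, 0 < ρ → f ρ ≤ 2 / ρ := by
    intro ρ hρ
    rw [show f ρ = 1 / ρ * rateQPSK T ρ from rfl, one_div_mul_eq_div]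
    gcongr
    exact rateQPSK_le_two T ρ
  set a := min ρ₁ (f ρ₁ / (A + 1)) with ha
  set b := max ρ₁ (2 / f ρ₁) with hb
  have ha0 : 0 < a := lt_min hρ₁ (by positivity)
  have hmem : ρ₁ ∈ Set.Icc a b := ⟨min_le_left _ _, le_max_left _ _⟩
  have hcont : ContinuousOn f (Set.Icc a b) :=
    (continuousOn_const.div continuousOn_id fun ρ hρ => (ha0.trans_le hρ.1).ne').mul
      (continuous_rateQPSK T).continuousOn
  obtain ⟨ρc, hρc, hmax⟩ := isCompact_Icc.exists_isMaxOn ⟨ρ₁, hmem⟩ hcont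
  refine ⟨ρc, ha0.trans_le hρc.1, fun ρ hρ => ?_⟩
  have hρ : 0 < ρ := hρ
  change f ρ ≤ f ρc
  by_cases h1 : ρ < a
  · refine ((hlow ρ hρ).trans ?_).trans (hmax hmem)
    have : ρ ≤ f ρ₁ / (A + 1) := h1.le.trans (min_le_right _ _)
    rw [le_div_iff₀ (by positivity)] at this
    linarith
  by_cases h2 : b < ρ
  · refine ((hhigh ρ hρ).trans ?_).trans (hmax hmem)
    have : 2 / f ρ₁ ≤ ρ := (le_max_right _ _).trans h2.le
    rw [div_le_iff₀ hv] at this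
    rw [div_le_iff₀ hρ]
    linarith
  · exact hmax ⟨not_lt.1 h1, not_lt.1 h2⟩

/-! ### Sums over words -/

section Words

variable {ι α : Type*} [Fintype ι] [DecidableEq ι] [Fintype α]

/-- Averaging out one coordinate of a word; exchanging the coordinate `σ t` with an independent
letter `a` is an involution on pairs `(σ, a)`. -/
lemma card_mul_sum_mul_apply {t : ι} {φ : (ι → α) → ℝ} (hφ : DependsOn φ {t}ᶜ) (q : α → ℝ) :
    (Fintype.card α : ℝ) * ∑ σ, φ σ * q (σ t) = (∑ σ, φ σ) * ∑ a, q a := by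
  let e : (ι → α) × α ≃ (ι → α) × α := Function.Involutive.toPerm
    (fun v => (Function.update v.1 t v.2, v.1 t)) fun v => by simp
  have he : ∀ σ a, e (σ, a) = (Function.update σ t a, σ t) := fun _ _ => rfl
  have h : ∀ σ a, φ (Function.update σ t a) = φ σ := fun σ a =>
    hφ fun i hi => Function.update_of_ne hi _ _
  calc (Fintype.card α : ℝ) * ∑ σ, φ σ * q (σ t)
      = ∑ v : (ι → α) × α, φ (e v).1 * q (e v).2 := by
        rw [Fintype.sum_prod_type, Finset.mul_sum]
        simp [he, h]
    _ = ∑ v : (ι → α) × α, φ v.1 * q v.2 := e.sum_comp fun v => φ v.1 * q v.2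
    _ = (∑ σ, φ σ) * ∑ a, q a := by
        rw [Fintype.sum_prod_type, Finset.sum_mul_sum]

/-- A sum over binary words of a function of the number of zeros. -/
lemma sum_bool_word {M : Type*} [AddCommMonoid M] (F : ℕ → M) :
    ∑ b : ι → Bool, F (Finset.univ.filter fun t => b t = false).card =
      ∑ k ∈ Finset.range (Fintype.card ι + 1), (Fintype.card ι).choose k • F k := by
  rw [← Finset.card_univ, ← Finset.sum_powerset_apply_card]
  refine Finset.sum_nbij' (fun b => Finset.univ.filter fun t => b t = false)
    (fun s t => decide (t ∉ s)) ?_ ?_ ?_ ?_ ?_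
  · simp
  · simp
  · intro b _
    ext t
    simp
  · intro s _
    ext t
    simp
  · simp

end Words

/-! ### The law of the rotated output word -/

/-- The conditional probability of a rotated output letter, given the standard normal fading
components `g`. -/
noncomputable def letterProb (ρ : ℝ) (s : Bool × Bool) (g : ℝ × ℝ) : ℝ :=
  stdNormalCDF (sgn s.1 * (g.1 * √ρ)) * stdNormalCDF (sgn s.2 * (g.2 * √ρ))

lemma letterProb_nonneg (ρ : ℝ) (s : Bool × Bool) (g : ℝ × ℝ) : 0 ≤ letterProb ρ s g :=
  mul_nonneg (stdNormalCDF_nonneg _) (stdNormalCDF_nonneg _)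

lemma letterProb_le_one (ρ : ℝ) (s : Bool × Bool) (g : ℝ × ℝ) : letterProb ρ s g ≤ 1 :=
  mul_le_one₀ (stdNormalCDF_le_one _) (stdNormalCDF_nonneg _) (stdNormalCDF_le_one _)

lemma sum_letterProb (ρ : ℝ) (g : ℝ × ℝ) : ∑ s, letterProb ρ s g = 1 := by
  simp only [letterProb, Fintype.sum_prod_type, Fintype.sum_bool, sgn_true, sgn_false, neg_mul,
    one_mul, stdNormalCDF_neg]
  ring

@[fun_prop]
lemma measurable_letterProb (ρ : ℝ) (s : Bool × Bool) : Measurable (letterProb ρ s) := by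
  unfold letterProb
  fun_prop

section Word

variable {ι : Type*}

/-- The probability that the rotated output word agrees with `σ` at the times in `A`. -/
noncomputable def wordProb (ρ : ℝ) (A : Finset ι) (σ : ι → Bool × Bool) : ℝ :=
  ∫ g, ∏ t ∈ A, letterProb ρ (σ t) g ∂((gaussianReal 0 1).prod (gaussianReal 0 1))

lemma integrable_prod_letterProb (ρ : ℝ) (A : Finset ι) (σ : ι → Bool × Bool) :
    Integrable (fun g => ∏ t ∈ A, letterProb ρ (σ t) g)
      ((gaussianReal 0 1).prod (gaussianReal 0 1)) := by
  refine Integrable.of_bound (by fun_prop) 1 (.of_forall fun g => ?_)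
  rw [Real.norm_of_nonneg (Finset.prod_nonneg fun t _ => letterProb_nonneg _ _ _)]
  exact Finset.prod_le_one (fun t _ => letterProb_nonneg _ _ _) fun t _ => letterProb_le_one _ _ _

lemma prod_stdNormalCDF_sgn (A : Finset ι) (b : ι → Bool) (x : ℝ) :
    ∏ t ∈ A, stdNormalCDF (sgn (b t) * x) =
      stdNormalCDF (-x) ^ (A.filter fun t => b t = false).card *
        stdNormalCDF x ^ (A.filter fun t => ¬ b t = false).card := by
  rw [← Finset.prod_const, ← Finset.prod_const,
    ← Finset.prod_filter_mul_prod_filter_not A fun t => b t = false]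
  congr 1 <;> refine Finset.prod_congr rfl fun t ht => ?_ <;>
    have := (Finset.mem_filter.1 ht).2 <;> simp_all

/-- Real and imaginary parts of the rotated output are independent, and within each of them the
probability of a word depends only on its number of negative signs. -/
lemma wordProb_eq_gammaCoeff (ρ : ℝ) (A : Finset ι) (σ : ι → Bool × Bool) :
    wordProb ρ A σ =
      gammaCoeff ρ (A.filter fun t => (σ t).1 = false).card
        (A.filter fun t => ¬ (σ t).1 = false).card *
      gammaCoeff ρ (A.filter fun t => (σ t).2 = false).card
        (A.filter fun t => ¬ (σ t).2 = false).card := by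
  rw [gammaCoeff, gammaCoeff, ← integral_prod_mul]
  refine integral_congr_ae (.of_forall fun g => ?_)
  simp only [letterProb, Finset.prod_mul_distrib]
  rw [prod_stdNormalCDF_sgn A fun t => (σ t).1, prod_stdNormalCDF_sgn A fun t => (σ t).2,
    neg_mul, neg_mul]

lemma wordProb_pos (ρ : ℝ) (A : Finset ι) (σ : ι → Bool × Bool) : 0 < wordProb ρ A σ := by
  rw [wordProb_eq_gammaCoeff]
  exact mul_pos (gammaCoeff_pos _ _ _) (gammaCoeff_pos _ _ _)

lemma wordProb_empty (ρ : ℝ) (σ : ι → Bool × Bool) : wordProb ρ ∅ σ = 1 := by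
  simp [wordProb]

lemma wordProb_singleton (ρ : ℝ) (t : ι) (σ : ι → Bool × Bool) : wordProb ρ {t} σ = 1 / 4 := by
  have h10 : gammaCoeff ρ 1 0 = 1 / 2 ∧ gammaCoeff ρ 0 1 = 1 / 2 := by
    have h1 : gammaCoeff ρ 0 1 = gammaCoeff ρ 1 0 := by
      simp only [gammaCoeff, pow_zero, pow_one, one_mul, mul_one]
      conv_lhs => rw [← neg_zero, ← gaussianReal_map_neg]
      rw [integral_map (by fun_prop) (by fun_prop)]
    have h2 := sum_choose_mul_gammaCoeff 1 ρ
    rw [Finset.sum_range_succ, Finset.sum_range_one] at h2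
    norm_num at h2
    constructor <;> linarith
  rw [wordProb_eq_gammaCoeff]
  cases h1 : (σ t).1 <;> cases h2 : (σ t).2 <;>
    simp [Finset.filter_singleton, h1, h2, h10.1, h10.2] <;> norm_num

lemma sum_sgn (A : Finset ι) (b : ι → Bool) :
    ∑ t ∈ A, sgn (b t) = A.card - 2 * (A.filter fun t => b t = false).card := by
  have : ∀ t, sgn (b t) = 1 - 2 * if b t = false then 1 else 0 := by
    intro t
    cases b t <;> norm_num
  rw [Finset.sum_congr rfl fun t _ => this t, Finset.sum_sub_distrib, ← Finset.mul_sum,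
    Finset.sum_boole]
  simp

lemma card_filter_eq_of_sum_sgn_eq {A : Finset ι} {b c : ι → Bool}
    (h : ∑ t ∈ A, sgn (b t) = ∑ t ∈ A, sgn (c t)) :
    (A.filter fun t => b t = false).card = (A.filter fun t => c t = false).card ∧
      (A.filter fun t => ¬ b t = false).card = (A.filter fun t => ¬ c t = false).card := by
  rw [sum_sgn, sum_sgn] at h
  have h1 : (A.filter fun t => b t = false).card = (A.filter fun t => c t = false).card := by
    have : ((A.filter fun t => b t = false).card : ℝ) = (A.filter fun t => c t = false).card := by
      linarith
    exact_mod_cast this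
  have hb := Finset.card_filter_add_card_filter_not (s := A) fun t => b t = false
  have hc := Finset.card_filter_add_card_filter_not (s := A) fun t => c t = false
  exact ⟨h1, by omega⟩

/-- The sum of the rotated output letters is a sufficient statistic for the fading. -/
lemma wordProb_eq_of_sum_letter_eq (ρ : ℝ) {A : Finset ι} {σ τ : ι → Bool × Bool}
    (h : ∑ t ∈ A, letter (σ t) = ∑ t ∈ A, letter (τ t)) : wordProb ρ A σ = wordProb ρ A τ := by
  have hre := congrArg Complex.re h
  have him := congrArg Complex.im h
  simp only [Complex.re_sum, Complex.im_sum, letter] at hre him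
  obtain ⟨h1, h2⟩ := card_filter_eq_of_sum_sgn_eq hre
  obtain ⟨h3, h4⟩ := card_filter_eq_of_sum_sgn_eq him
  rw [wordProb_eq_gammaCoeff, wordProb_eq_gammaCoeff, h1, h2, h3, h4]

variable [Fintype ι] [DecidableEq ι]

lemma four_mul_sum_mul_wordProb_insert (ρ : ℝ) {A : Finset ι} {t : ι} (ht : t ∉ A)
    {φ : (ι → Bool × Bool) → ℝ} (hφ : DependsOn φ {t}ᶜ) :
    4 * ∑ σ, φ σ * wordProb ρ (insert t A) σ = ∑ σ, φ σ * wordProb ρ A σ := by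
  simp only [wordProb, ← integral_const_mul]
  rw [← integral_finsetSum _ fun σ _ => (integrable_prod_letterProb ρ _ σ).const_mul _,
    ← integral_finsetSum _ fun σ _ => (integrable_prod_letterProb ρ _ σ).const_mul _,
    ← integral_const_mul]
  refine integral_congr_ae (.of_forall fun g => ?_)
  have h := card_mul_sum_mul_apply (t := t)
    (φ := fun σ => φ σ * ∏ i ∈ A, letterProb ρ (σ i) g) (fun σ τ hστ => by
      dsimp only
      rw [hφ hστ]
      congr 1
      refine Finset.prod_congr rfl fun i hi => ?_
      rw [hστ i (ne_of_mem_of_not_mem hi ht)]) fun s => letterProb ρ s g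
  rw [sum_letterProb, mul_one] at h
  simp only [Fintype.card_prod, Fintype.card_bool] at h
  norm_num at h
  simp only [Finset.prod_insert ht]
  rw [← h]
  congr 1
  exact Finset.sum_congr rfl fun σ _ => by ring

/-- Averaging out all the coordinates of the output word outside `A`. -/
lemma four_pow_mul_sum_mul_wordProb (ρ : ℝ) {A : Finset ι} {φ : (ι → Bool × Bool) → ℝ}
    (hφ : DependsOn φ (A : Set ι)) :
    4 ^ (Aᶜ).card * ∑ σ, φ σ * wordProb ρ Finset.univ σ = ∑ σ, φ σ * wordProb ρ A σ := by
  have key : ∀ C : Finset ι, Disjoint A C →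
      4 ^ C.card * ∑ σ, φ σ * wordProb ρ (A ∪ C) σ = ∑ σ, φ σ * wordProb ρ A σ := by
    intro C
    induction C using Finset.induction_on with
    | empty => simp
    | insert t C ht ih =>
      intro hd
      rw [Finset.disjoint_insert_right] at hd
      rw [← ih hd.2, Finset.card_insert_of_notMem ht, pow_succ, mul_assoc, Finset.union_insert,
        four_mul_sum_mul_wordProb_insert ρ (by simp [hd.1, ht])
          (hφ.mono fun i hi => ne_of_mem_of_not_mem hi hd.1)]
  have := key Aᶜ disjoint_compl_right
  rwa [Finset.union_compl] at this

lemma sum_wordProb (ρ : ℝ) : ∑ σ : ι → Bool × Bool, wordProb ρ Finset.univ σ = 1 := by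
  have h := four_pow_mul_sum_mul_wordProb ρ (A := (∅ : Finset ι)) (φ := fun _ => 1)
    (fun _ _ _ => rfl)
  simp only [Finset.compl_empty, one_mul, wordProb_empty, Finset.sum_const, Finset.card_univ,
    Fintype.card_fun, Fintype.card_prod, Fintype.card_bool] at h
  norm_num at h
  exact h

lemma sum_ite_wordProb (ρ : ℝ) (t : ι) (s : Bool × Bool) :
    ∑ σ : ι → Bool × Bool, (if σ t = s then 1 else 0) * wordProb ρ Finset.univ σ = 1 / 4 := by
  have h := four_pow_mul_sum_mul_wordProb ρ (A := {t})
    (φ := fun σ : ι → Bool × Bool => if σ t = s then 1 else 0)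
    (fun σ τ h => by simp only; rw [h t (by simp)])
  have h1 := card_mul_sum_mul_apply (t := t) (φ := fun _ : ι → Bool × Bool => 1)
    (fun _ _ _ => rfl) fun a => if a = s then 1 else 0
  have hpos : (0 : ℝ) < 4 ^ ({t}ᶜ : Finset ι).card := by positivity
  have hc : Fintype.card ι = ({t}ᶜ : Finset ι).card + 1 := by
    rw [← Finset.card_add_card_compl {t}, Finset.card_singleton, add_comm]
  simp only [wordProb_singleton, ← Finset.sum_mul] at h
  simp only [one_mul, Finset.sum_const, Finset.card_univ, Fintype.card_fun, Fintype.card_prod,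
    Fintype.card_bool, Finset.sum_ite_eq', Finset.mem_univ, if_true, hc] at h1
  norm_num [pow_succ] at h1
  have h2 : ∑ σ : ι → Bool × Bool, (if σ t = s then (1 : ℝ) else 0) =
      4 ^ ({t}ᶜ : Finset ι).card := by
    simp only [Finset.sum_boole]
    linarith
  rw [h2] at h
  exact mul_left_cancel₀ hpos.ne' h

/-- The conditional probability of the letter at time `n`, given the sum of the letters at the
times in `A`, equals its conditional probability given all these letters. -/
lemma sum_mul_wordProb_eq (ρ : ℝ) {A : Finset ι} {n : ι} (hn : n ∉ A) (σ₀ : ι → Bool × Bool) :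
    (∑ σ, (if σ n = σ₀ n ∧ ∑ t ∈ A, letter (σ t) = ∑ t ∈ A, letter (σ₀ t) then 1 else 0) *
        wordProb ρ Finset.univ σ) * wordProb ρ A σ₀ =
      (∑ σ, (if ∑ t ∈ A, letter (σ t) = ∑ t ∈ A, letter (σ₀ t) then 1 else 0) *
        wordProb ρ Finset.univ σ) * wordProb ρ (insert n A) σ₀ := by
  set z : (ι → Bool × Bool) → ℂ := fun σ => ∑ t ∈ A, letter (σ t) with hz
  have hzd : DependsOn z (A : Set ι) := fun σ τ h =>
    Finset.sum_congr rfl fun t ht => by rw [h t ht]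
  set φ : (ι → Bool × Bool) → ℝ := fun σ => if z σ = z σ₀ then 1 else 0 with hφ
  set ψ : (ι → Bool × Bool) → ℝ := fun σ => if σ n = σ₀ n ∧ z σ = z σ₀ then 1 else 0 with hψ
  have hφd : DependsOn φ (A : Set ι) := fun σ τ h => by simp only [hφ, hzd h]
  have hψd : DependsOn ψ (insert n A : Finset ι) := fun σ τ h => by
    simp only [hψ, hzd fun i hi => h i (by simp [Finset.mem_coe.1 hi]), h n (by simp)]
  have h1 := four_pow_mul_sum_mul_wordProb ρ hφd
  have h2 := four_pow_mul_sum_mul_wordProb ρ hψd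
  have h3 : ∑ σ, φ σ * wordProb ρ A σ = (∑ σ, φ σ) * wordProb ρ A σ₀ := by
    rw [Finset.sum_mul]
    refine Finset.sum_congr rfl fun σ _ => ?_
    by_cases h : z σ = z σ₀
    · rw [wordProb_eq_of_sum_letter_eq ρ h]
    · simp [hφ, h]
  have h4 : ∑ σ, ψ σ * wordProb ρ (insert n A) σ = (∑ σ, ψ σ) * wordProb ρ (insert n A) σ₀ := by
    rw [Finset.sum_mul]
    refine Finset.sum_congr rfl fun σ _ => ?_
    by_cases h : σ n = σ₀ n ∧ z σ = z σ₀
    · rw [wordProb_eq_of_sum_letter_eq ρ (σ := σ) (τ := σ₀)]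
      rw [Finset.sum_insert hn, Finset.sum_insert hn, h.1]
      exact congrArg _ h.2
    · simp [hψ, h]
  have h5 : 4 * ∑ σ, ψ σ = ∑ σ, φ σ := by
    have h := card_mul_sum_mul_apply (t := n) (φ := φ)
      (hφd.mono fun i hi => ne_of_mem_of_not_mem hi hn) fun s => if s = σ₀ n then 1 else 0
    simp only [Fintype.card_prod, Fintype.card_bool, Finset.sum_ite_eq', Finset.mem_univ,
      if_true] at h
    norm_num at h
    rw [← h]
    congr 1
    refine Finset.sum_congr rfl fun σ _ => ?_
    by_cases ha : σ n = σ₀ n <;> by_cases hb : z σ = z σ₀ <;> simp [hψ, hφ, ha, hb]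
  have hc : (Aᶜ).card = ((insert n A)ᶜ).card + 1 := by
    have e1 := Finset.card_add_card_compl A
    have e2 := Finset.card_add_card_compl (insert n A)
    rw [Finset.card_insert_of_notMem hn] at e2
    omega
  rw [h3, hc, pow_succ, ← h5] at h1
  rw [h4] at h2
  have hpos : (0 : ℝ) < 4 ^ ((insert n A)ᶜ).card := by positivity
  refine mul_left_cancel₀ hpos.ne' ?_
  linear_combination wordProb ρ A σ₀ * h2 - wordProb ρ (insert n A) σ₀ / 4 * h1

/-- Minus the entropy of the rotated output word: twice that of a real sign word. -/
lemma sum_wordProb_mul_logb (ρ : ℝ) :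
    ∑ σ : ι → Bool × Bool,
        wordProb ρ Finset.univ σ * Real.logb 2 (wordProb ρ Finset.univ σ) =
      2 * ∑ k ∈ Finset.range (Fintype.card ι + 1), ((Fintype.card ι).choose k : ℝ) *
        gammaCoeff ρ k (Fintype.card ι - k) *
          Real.logb 2 (gammaCoeff ρ k (Fintype.card ι - k)) := by
  set T := Fintype.card ι with hT
  set c : (ι → Bool) → ℕ := fun b => (Finset.univ.filter fun t => b t = false).card with hc
  set h : (ι → Bool) → ℝ := fun b => gammaCoeff ρ (c b) (T - c b) with hh
  have hW : ∀ σ : ι → Bool × Bool, wordProb ρ Finset.univ σ =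
      h (fun t => (σ t).1) * h (fun t => (σ t).2) := by
    have hcompl : ∀ b : ι → Bool, (Finset.univ.filter fun t => ¬ b t = false).card = T - c b := by
      intro b
      have := Finset.card_filter_add_card_filter_not (s := Finset.univ) fun t => b t = false
      rw [Finset.card_univ] at this
      simp only [hc]
      omega
    intro σ
    rw [wordProb_eq_gammaCoeff, hcompl fun t => (σ t).1, hcompl fun t => (σ t).2]
  have hsum1 : ∑ b, h b = 1 := by
    rw [hh, hc, sum_bool_word fun k => gammaCoeff ρ k (T - k)]
    simp only [nsmul_eq_mul]
    exact sum_choose_mul_gammaCoeff T ρ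
  have hsumlog : ∑ b, h b * Real.logb 2 (h b) = ∑ k ∈ Finset.range (T + 1), (T.choose k : ℝ) *
      gammaCoeff ρ k (T - k) * Real.logb 2 (gammaCoeff ρ k (T - k)) := by
    rw [hh, hc, sum_bool_word fun k => gammaCoeff ρ k (T - k) * Real.logb 2 (gammaCoeff ρ k (T - k))]
    simp only [nsmul_eq_mul, mul_assoc]
    rfl
  rw [← hsumlog, ← (Equiv.arrowProdEquivProdArrow ι (fun _ => Bool) (fun _ => Bool)).symm.sum_comp,
    Fintype.sum_prod_type]
  simp only [hW, Equiv.arrowProdEquivProdArrow_symm_apply]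
  have hlog : ∀ b b' : ι → Bool, h b * h b' * Real.logb 2 (h b * h b') =
      h b * Real.logb 2 (h b) * h b' + h b * (h b' * Real.logb 2 (h b')) := by
    intro b b'
    rw [Real.logb_mul (gammaCoeff_pos _ _ _).ne' (gammaCoeff_pos _ _ _).ne']
    ring
  simp only [hlog, Finset.sum_add_distrib, ← Finset.mul_sum, ← Finset.sum_mul, hsum1]
  ring

end Word

/-! ### QPSK symbols and the rotation they cause -/

/-- The QPSK symbol of power `ρ` encoded by a pair of bits. -/
noncomputable def symbol (ρ : ℝ) (k : Bool × Bool) : ℂ := (√(ρ / 2) : ℂ) * letter k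

/-- Multiplication of output letters by the power of `j` that takes `1 + j` to `letter k`. -/
def rotate (k s : Bool × Bool) : Bool × Bool :=
  if k.1 = k.2 then (s.1 == k.1, s.2 == k.2) else (s.2 == k.1, s.1 == k.2)

lemma rotate_injective (k : Bool × Bool) : Function.Injective (rotate k) := by
  revert k
  decide

lemma rotate_left_injective (s : Bool × Bool) : Function.Injective fun k => rotate k s := by
  revert s
  decide

lemma exists_mem_qpsk {ρ : ℝ} {z : ℂ} : z ∈ qpsk ρ ↔ ∃ k, symbol ρ k = z := by
  constructor
  · rintro ⟨a, ha, b, hb, rfl⟩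
    have h : ∀ a ∈ ({1, -1} : Set ℝ), ∃ k, sgn k = a := by
      rintro a (rfl | rfl)
      exacts [⟨true, rfl⟩, ⟨false, rfl⟩]
    obtain ⟨k, rfl⟩ := h a ha
    obtain ⟨l, rfl⟩ := h b hb
    exact ⟨(k, l), rfl⟩
  · rintro ⟨k, rfl⟩
    have h : ∀ k, sgn k ∈ ({1, -1} : Set ℝ) := by
      intro k
      cases k <;> simp
    exact ⟨_, h k.1, _, h k.2, rfl⟩

lemma letter_ne_zero (k : Bool × Bool) : letter k ≠ 0 := by
  intro h
  have := congrArg Complex.re h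
  rcases k with ⟨_ | _, b⟩ <;> simp [letter] at this

lemma sqrt_half_ne_zero {ρ : ℝ} (hρ : 0 < ρ) : (√(ρ / 2) : ℂ) ≠ 0 := by
  have : √(ρ / 2) ≠ 0 := by positivity
  exact_mod_cast this

lemma symbol_ne_zero {ρ : ℝ} (hρ : 0 < ρ) (k : Bool × Bool) : symbol ρ k ≠ 0 :=
  mul_ne_zero (sqrt_half_ne_zero hρ) (letter_ne_zero k)

lemma symbol_injective {ρ : ℝ} (hρ : 0 < ρ) : Function.Injective (symbol ρ) := fun _ _ h =>
  letter_injective (mul_left_cancel₀ (sqrt_half_ne_zero hρ) h)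

lemma norm_symbol_sq {ρ : ℝ} (hρ : 0 < ρ) (k : Bool × Bool) : ‖symbol ρ k‖ ^ 2 = ρ := by
  have h : ‖letter k‖ ^ 2 = 2 := by
    rw [← Complex.normSq_eq_norm_sq, Complex.normSq_apply]
    rcases k with ⟨_ | _, _ | _⟩ <;> simp [letter] <;> norm_num
  rw [symbol, norm_mul, mul_pow, h, Complex.norm_real, Real.norm_eq_abs, sq_abs,
    Real.sq_sqrt (by positivity)]
  ring

/-- Matched filtering undoes the rotation. -/
lemma star_symbol_mul_letter_rotate (ρ : ℝ) (k s : Bool × Bool) :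
    star (symbol ρ k) * letter (rotate k s) = (√(ρ / 2) : ℂ) * ⟨1, -1⟩ * letter s := by
  have h : star (letter k) * letter (rotate k s) = ⟨1, -1⟩ * letter s := by
    rcases k with ⟨_ | _, _ | _⟩ <;> rcases s with ⟨_ | _, _ | _⟩ <;>
      simp [letter, rotate, Complex.ext_iff]
  rw [symbol, star_mul', mul_assoc, h, mul_assoc]
  congr 1
  exact Complex.conj_ofReal _

/-! ### The law of one block given the input -/

/-- The joint law of fading and noise. -/
noncomputable abbrev channelLaw (T : ℕ) : Measure (ℂ × (Fin T → ℂ)) :=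
  complexGaussian.prod (Measure.pi fun _ : Fin T => complexGaussian)

lemma measurable_channel_output {T : ℕ} (x : Fin T → ℂ) :
    Measurable fun (v : ℂ × (Fin T → ℂ)) (t : Fin T) => quantize (x t * v.1 + v.2 t) := by
  fun_prop

lemma channelLaw_real_output_eq {T : ℕ} (x : Fin T → ℂ) (τ : Fin T → Bool × Bool) :
    (channelLaw T).real ((fun v t => quantize (x t * v.1 + v.2 t)) ⁻¹' {fun t => letter (τ t)}) =
      ∫ h, ∏ t, (stdNormalCDF (sgn (τ t).1 * (√2 * (x t * h).re)) *
        stdNormalCDF (sgn (τ t).2 * (√2 * (x t * h).im))) ∂complexGaussian := by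
  have hm : MeasurableSet
      ((fun (v : ℂ × (Fin T → ℂ)) t => quantize (x t * v.1 + v.2 t)) ⁻¹'
        {fun t => letter (τ t)}) :=
    measurable_channel_output x (measurableSet_singleton _)
  rw [measureReal_def, Measure.prod_apply hm,
    ← integral_toReal (measurable_measure_prodMk_left hm).aemeasurable
      (.of_forall fun _ => measure_lt_top _ _)]
  refine integral_congr_ae (.of_forall fun h => ?_)
  have hs : Prod.mk h ⁻¹' ((fun (v : ℂ × (Fin T → ℂ)) t => quantize (x t * v.1 + v.2 t)) ⁻¹'
        {fun t => letter (τ t)}) =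
      Set.pi Set.univ fun t => {w | quantize (x t * h + w) = letter (τ t)} := by
    ext w
    simp [funext_iff]
  simp only [hs, Measure.pi_pi, ENNReal.toReal_prod]
  exact Finset.prod_congr rfl fun t _ => real_quantize_eq_letter _ _

/-- Without input, the output word is uniformly distributed. -/
lemma channelLaw_real_output_zero {T : ℕ} (τ : Fin T → Bool × Bool) :
    (channelLaw T).real
      ((fun v t => quantize ((0 : Fin T → ℂ) t * v.1 + v.2 t)) ⁻¹' {fun t => letter (τ t)}) =
      1 / 4 ^ T := by
  rw [channelLaw_real_output_eq]
  simp [stdNormalCDF_zero]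
  rw [← mul_inv, inv_pow]
  norm_num

/-- Given QPSK symbols, the output word is the rotation of a word whose law does not depend on
these symbols. -/
lemma channelLaw_real_output_symbol {T : ℕ} (ρ : ℝ) (κ σ : Fin T → Bool × Bool) :
    (channelLaw T).real ((fun v t => quantize (symbol ρ (κ t) * v.1 + v.2 t)) ⁻¹'
        {fun t => letter (rotate (κ t) (σ t))}) = wordProb ρ Finset.univ σ := by
  rw [channelLaw_real_output_eq (fun t => symbol ρ (κ t)) fun t => rotate (κ t) (σ t), wordProb,
    ← map_complexGaussian, integral_map (by fun_prop) (by fun_prop)]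
  refine integral_congr_ae (.of_forall fun h => Finset.prod_congr rfl fun t _ => ?_)
  have h2 : √2 * √(ρ / 2) = √ρ := by
    rw [← Real.sqrt_mul (by norm_num)]
    congr 1
    ring
  have hre : √2 * (symbol ρ (κ t) * h).re =
      √ρ * (sgn (κ t).1 * h.re - sgn (κ t).2 * h.im) := by
    rw [← h2]
    simp [symbol, letter]
    ring
  have him : √2 * (symbol ρ (κ t) * h).im =
      √ρ * (sgn (κ t).1 * h.im + sgn (κ t).2 * h.re) := by
    rw [← h2]
    simp [symbol, letter]
    ring
  rw [hre, him, letterProb]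
  generalize κ t = k, σ t = s
  rcases k with ⟨_ | _, _ | _⟩ <;> rcases s with ⟨_ | _, _ | _⟩ <;>
    simp [rotate] <;> ring_nf

open Classical in
lemma channelLaw_real_output_mem {T : ℕ} (x : Fin T → ℂ) (B : Set (Fin T → ℂ)) :
    (channelLaw T).real ((fun v t => quantize (x t * v.1 + v.2 t)) ⁻¹' B) =
      ∑ τ : Fin T → Bool × Bool, (channelLaw T).real
        ((fun v t => quantize (x t * v.1 + v.2 t)) ⁻¹' {fun t => letter (τ t)}) *
          if (fun t => letter (τ t)) ∈ B then 1 else 0 := by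
  have hinj : Function.Injective fun (τ : Fin T → Bool × Bool) t => letter (τ t) :=
    letter_injective.comp_left
  simp only [mul_ite, mul_one, mul_zero]
  rw [← Finset.sum_filter, ← Finset.sum_image (s := Finset.univ.filter
    fun τ : Fin T → Bool × Bool => (fun t => letter (τ t)) ∈ B)
    (g := fun (τ : Fin T → Bool × Bool) t => letter (τ t)) (f := fun y => (channelLaw T).real
      ((fun v t => quantize (x t * v.1 + v.2 t)) ⁻¹' {y})) hinj.injOn,
    sum_measureReal_preimage_singleton _
      fun y _ => measurable_channel_output x (measurableSet_singleton y)]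
  congr 1
  ext v
  choose s hs using fun t => exists_quantize_eq_letter (x t * v.1 + v.2 t)
  simp only [Set.mem_preimage, hs, Finset.coe_image, Finset.coe_filter, Finset.mem_univ, true_and,
    Set.mem_image, Set.mem_ofPred_eq]
  exact ⟨fun h => ⟨s, h, rfl⟩, fun ⟨τ, h, e⟩ => e ▸ h⟩

/-! ### The joint law of input and output -/

lemma uniformOn_range {ι α : Type*} [Fintype ι] [Nonempty ι] [MeasurableSpace α]
    [MeasurableSingletonClass α] {f : ι → α} (hf : Function.Injective f) :
    uniformOn (Set.range f) = (Fintype.card ι : ENNReal)⁻¹ • ∑ i, Measure.dirac (f i) := by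
  classical
  have hs : MeasurableSet (Set.range f) := (Set.finite_range f).measurableSet
  ext s hsm
  have h1 : Measure.count (Set.range f) = Fintype.card ι := by
    rw [← Set.image_univ, ← Finset.coe_univ, ← Finset.coe_image, Measure.count_apply_finset,
      Finset.card_image_of_injective _ hf, Finset.card_univ]
  have h2 : Measure.count (Set.range f ∩ s) = ∑ i, Measure.dirac (f i) s := by
    have : Set.range f ∩ s = ((Finset.univ.filter fun i => f i ∈ s).image f : Finset α) := by
      ext y
      simp only [Set.mem_inter_iff, Set.mem_range, Finset.coe_image, Finset.coe_filter,
        Finset.mem_univ, true_and, Set.mem_image, Set.mem_ofPred_eq]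
      constructor
      · rintro ⟨⟨i, rfl⟩, h⟩
        exact ⟨i, h, rfl⟩
      · rintro ⟨i, h, rfl⟩
        exact ⟨⟨i, rfl⟩, h⟩
    rw [this, Measure.count_apply_finset, Finset.card_image_of_injective _ hf, Finset.card_filter]
    simp [Measure.dirac_apply' _ hsm, Set.indicator_apply]
  rw [uniformOn, cond_apply hs, h1, h2]
  simp [Measure.finsetSum_apply]

/-- The bits of an active block: those of the pilot, followed by those of the data symbols. -/
def activeBits {m : ℕ} (c : Bool × Bool) (u : Fin m → Bool × Bool) : Fin (m + 1) → Bool × Bool :=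
  Fin.cons c u

lemma activeBits_zero {m : ℕ} (c : Bool × Bool) (u : Fin m → Bool × Bool) :
    activeBits c u 0 = c := rfl

lemma activeBits_succ {m : ℕ} (c : Bool × Bool) (u : Fin m → Bool × Bool) (i : Fin m) :
    activeBits c u i.succ = u i := rfl

lemma activeWord_injective {m : ℕ} {ρ : ℝ} (hρ : 0 < ρ) (c : Bool × Bool) :
    Function.Injective fun (u : Fin m → Bool × Bool) t => symbol ρ (activeBits c u t) := by
  intro u v h
  funext i
  exact symbol_injective hρ (congrFun h i.succ)

lemma pilotWords_eq_range {m : ℕ} (ρ : ℝ) (c : Bool × Bool) :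
    pilotWords (m + 1) ρ (symbol ρ c) =
      Set.range fun (u : Fin m → Bool × Bool) t => symbol ρ (activeBits c u t) := by
  ext x
  constructor
  · intro hx
    have h : ∀ i : Fin m, ∃ k, symbol ρ k = x i.succ := by
      intro i
      have := hx i.succ
      rw [if_neg (by simp)] at this
      exact exists_mem_qpsk.1 this
    choose u hu using h
    refine ⟨u, funext fun t => ?_⟩
    cases t using Fin.cases with
    | zero => exact (hx 0).symm
    | succ i => exact hu i
  · rintro ⟨u, rfl⟩ t
    cases t using Fin.cases with
    | zero => simp [activeBits_zero]
    | succ i =>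
      rw [if_neg (by simp)]
      exact exists_mem_qpsk.2 ⟨_, rfl⟩

lemma onOffInput_eq {m : ℕ} {ρ : ℝ} (hρ : 0 < ρ) (p : ℝ) (c : Bool × Bool) :
    onOffInput (m + 1) ρ p (symbol ρ c) = ENNReal.ofReal (1 - p) • Measure.dirac 0 +
      ENNReal.ofReal p • (((4 : ENNReal) ^ m)⁻¹ • ∑ u : Fin m → Bool × Bool,
        Measure.dirac fun t => symbol ρ (activeBits c u t)) := by
  rw [onOffInput, pilotWords_eq_range, uniformOn_range (activeWord_injective hρ c)]
  congr 4
  simp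

/-- A finite model of the joint law of input and output: `none` stands for a silent block, `some u`
for an active block with data bits `u`, and the second component is the output word, rotated
back in the case of an active block. -/
abbrev Outcome (m : ℕ) : Type := Option (Fin m → Bool × Bool) × (Fin (m + 1) → Bool × Bool)

/-- The probability of an outcome. -/
noncomputable def weight {m : ℕ} (ρ p : ℝ) : Outcome m → ℝ
  | (none, _) => (1 - p) / 4 ^ (m + 1)
  | (some _, σ) => p / 4 ^ m * wordProb ρ Finset.univ σ

/-- The input word of an outcome. -/
noncomputable def inputOf {m : ℕ} (ρ : ℝ) (c : Bool × Bool) : Outcome m → Fin (m + 1) → ℂ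
  | (none, _) => 0
  | (some u, _) => fun t => symbol ρ (activeBits c u t)

/-- The output word of an outcome. -/
noncomputable def outputOf {m : ℕ} (c : Bool × Bool) : Outcome m → Fin (m + 1) → ℂ
  | (none, σ) => fun t => letter (σ t)
  | (some u, σ) => fun t => letter (rotate (activeBits c u t) (σ t))

lemma sum_outcome {m : ℕ} (f : Outcome m → ℝ) :
    ∑ θ, f θ = ∑ σ, f (none, σ) + ∑ u, ∑ σ, f (some u, σ) := by
  rw [Fintype.sum_prod_type, Fintype.sum_option]

@[fun_prop]
lemma measurable_input {T : ℕ} : Measurable (input (T := T)) := measurable_fst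

@[fun_prop]
lemma measurable_output {T : ℕ} : Measurable (output (T := T)) := by
  unfold output
  fun_prop

open Classical in
/-- Input and output are distributed as the input and output words of a random outcome. -/
lemma blockLaw_real {m : ℕ} {ρ p : ℝ} (hρ : 0 < ρ) (hp : 0 ≤ p) (hp1 : p ≤ 1) (c : Bool × Bool)
    {A : Set ((Fin (m + 1) → ℂ) × (Fin (m + 1) → ℂ))} (hA : MeasurableSet A) :
    (blockLaw (onOffInput (m + 1) ρ p (symbol ρ c))).real {ω | (input ω, output ω) ∈ A} =
      ∑ θ : Outcome m, weight ρ p θ * if (inputOf ρ c θ, outputOf c θ) ∈ A then 1 else 0 := by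
  have hm : MeasurableSet {ω : Block (m + 1) | (input ω, output ω) ∈ A} :=
    (measurable_input.prodMk measurable_output) hA
  have hsec : ∀ x : Fin (m + 1) → ℂ,
      Prod.mk x ⁻¹' {ω : Block (m + 1) | (input ω, output ω) ∈ A} =
        (fun v t => quantize (x t * v.1 + v.2 t)) ⁻¹' (Prod.mk x ⁻¹' A) := fun x => rfl
  rw [measureReal_def, blockLaw, Measure.prod_apply hm, onOffInput_eq hρ]
  simp only [lintegral_add_measure, lintegral_smul_measure, lintegral_finsetSum_measure,
    lintegral_dirac' _ (measurable_measure_prodMk_left hm), smul_eq_mul]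
  simp only [hsec]
  rw [ENNReal.toReal_add (ENNReal.mul_ne_top ENNReal.ofReal_ne_top (measure_ne_top _ _))
    (ENNReal.mul_ne_top ENNReal.ofReal_ne_top (ENNReal.mul_ne_top (by simp)
      (ENNReal.sum_ne_top.2 fun _ _ => measure_ne_top _ _))),
    ENNReal.toReal_mul, ENNReal.toReal_mul, ENNReal.toReal_mul,
    ENNReal.toReal_ofReal (by linarith), ENNReal.toReal_ofReal hp,
    ENNReal.toReal_sum fun _ _ => measure_ne_top _ _, sum_outcome]
  simp only [← measureReal_def]
  congr 1
  · rw [channelLaw_real_output_mem, Finset.mul_sum]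
    refine Finset.sum_congr rfl fun σ _ => ?_
    rw [channelLaw_real_output_zero, ← mul_assoc, mul_one_div]
    rfl
  · rw [Finset.mul_sum, Finset.mul_sum]
    refine Finset.sum_congr rfl fun u _ => ?_
    rw [channelLaw_real_output_mem, Finset.mul_sum, Finset.mul_sum]
    have hb : Function.Bijective fun (σ : Fin (m + 1) → Bool × Bool) t =>
        rotate (activeBits c u t) (σ t) := by
      rw [Fintype.bijective_iff_injective_and_card]
      exact ⟨fun σ τ h => funext fun t => rotate_injective _ (congrFun h t), rfl⟩
    rw [← hb.sum_comp]
    refine Finset.sum_congr rfl fun σ _ => ?_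
    rw [channelLaw_real_output_symbol]
    simp only [weight, inputOf, outputOf, Set.mem_preimage, ENNReal.toReal_inv, ENNReal.toReal_pow,
      ENNReal.toReal_ofNat, div_eq_mul_inv, mul_assoc]
    congr!

/-! ### Information measures of finitely many outcomes -/

section Finite

variable {Ω α β γ Θ : Type*} [MeasurableSpace Ω] {μ : Measure Ω} [Fintype Θ]

open Classical in
/-- An expectation with respect to the law of `V`, written as a sum over the sample space. -/
lemma finsum_sum_ite_mul {δ : Type*} (w : Θ → ℝ) (V : Θ → δ) (f : δ → ℝ) :
    ∑ᶠ v, (∑ θ, w θ * if V θ = v then 1 else 0) * f v = ∑ θ, w θ * f (V θ) := by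
  rw [finsum_eq_sum_of_support_subset (s := Finset.univ.image V)]
  · simp only [Finset.sum_mul]
    rw [Finset.sum_comm]
    refine Finset.sum_congr rfl fun θ _ => ?_
    rw [Finset.sum_eq_single (V θ)]
    · simp
    · intro v _ hv
      simp [hv.symm]
    · simp
  · intro v hv
    by_contra hn
    refine hv ?_
    change (∑ θ, _) * f v = 0
    rw [Finset.sum_eq_zero, zero_mul]
    intro θ _
    rw [if_neg, mul_zero]
    rintro rfl
    exact hn (by simp)

open Classical in
lemma mutualInfo_eq_sum {X : Ω → α} {Y : Ω → β} (w : Θ → ℝ) (X' : Θ → α) (Y' : Θ → β)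
    (h : ∀ x y, μ.real {ω | X ω = x ∧ Y ω = y} =
      ∑ θ, w θ * if X' θ = x ∧ Y' θ = y then 1 else 0) :
    mutualInfo μ X Y = ∑ θ, w θ * Real.logb 2 (μ.real {ω | X ω = X' θ ∧ Y ω = Y' θ} /
      (μ.real {ω | X ω = X' θ} * μ.real {ω | Y ω = Y' θ})) := by
  rw [← finsum_sum_ite_mul w (fun θ => (X' θ, Y' θ)) fun v =>
    Real.logb 2 (μ.real {ω | X ω = v.1 ∧ Y ω = v.2} /
      (μ.real {ω | X ω = v.1} * μ.real {ω | Y ω = v.2}))]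
  refine finsum_congr fun v => ?_
  simp only [h, Prod.ext_iff]

open Classical in
lemma condMutualInfo_eq_sum {X : Ω → α} {Y : Ω → β} {Z : Ω → γ} (w : Θ → ℝ) (X' : Θ → α)
    (Y' : Θ → β) (Z' : Θ → γ)
    (h : ∀ x y z, μ.real {ω | X ω = x ∧ Y ω = y ∧ Z ω = z} =
      ∑ θ, w θ * if X' θ = x ∧ Y' θ = y ∧ Z' θ = z then 1 else 0) :
    condMutualInfo μ X Y Z = ∑ θ, w θ * Real.logb 2
      (μ.real {ω | Z ω = Z' θ} * μ.real {ω | X ω = X' θ ∧ Y ω = Y' θ ∧ Z ω = Z' θ} /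
        (μ.real {ω | X ω = X' θ ∧ Z ω = Z' θ} * μ.real {ω | Y ω = Y' θ ∧ Z ω = Z' θ})) := by
  rw [← finsum_sum_ite_mul w (fun θ => (X' θ, Y' θ, Z' θ)) fun v =>
    Real.logb 2 (μ.real {ω | Z ω = v.2.2} *
      μ.real {ω | X ω = v.1 ∧ Y ω = v.2.1 ∧ Z ω = v.2.2} /
      (μ.real {ω | X ω = v.1 ∧ Z ω = v.2.2} * μ.real {ω | Y ω = v.2.1 ∧ Z ω = v.2.2}))]
  refine finsum_congr fun v => ?_
  simp only [h, Prod.ext_iff]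

end Finite

/-! ### The information carried by one symbol -/

/-- Over uniformly distributed words, each letter is uniformly distributed. -/
lemma four_mul_sum_apply {ι : Type*} [Fintype ι] [DecidableEq ι] (t : ι) (q : Bool × Bool → ℝ) :
    4 * ∑ u : ι → Bool × Bool, q (u t) = 4 ^ Fintype.card ι * ∑ k, q k := by
  have h := card_mul_sum_mul_apply (t := t) (φ := fun _ : ι → Bool × Bool => 1)
    (fun _ _ _ => rfl) q
  simp only [one_mul, Finset.sum_const, Finset.card_univ, Fintype.card_fun, Fintype.card_prod,
    Fintype.card_bool] at h
  norm_num at h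
  exact h

/-- The times before `n`. -/
def past {T : ℕ} (n : Fin T) : Finset (Fin T) := Finset.univ.filter fun i => i < n

lemma notMem_past {T : ℕ} (n : Fin T) : n ∉ past n := by simp [past]

/-- The least-squares estimate before time `n` as a function of an input and an output word. -/
noncomputable def estimate {T : ℕ} (ρ : ℝ) (n : Fin T) (v : (Fin T → ℂ) × (Fin T → ℂ)) : ℂ :=
  1 / (((n : ℕ) : ℂ) * (√ρ : ℂ)) * ∑ i ∈ past n, star (v.1 i) * v.2 i

@[fun_prop]
lemma measurable_estimate {T : ℕ} (ρ : ℝ) (n : Fin T) : Measurable (estimate ρ n) := by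
  unfold estimate
  have : Measurable (star : ℂ → ℂ) := continuous_star.measurable
  fun_prop

lemma estimate_none {m : ℕ} (ρ : ℝ) (c : Bool × Bool) (n : Fin (m + 1))
    (σ : Fin (m + 1) → Bool × Bool) :
    estimate ρ n (inputOf ρ c (none, σ), outputOf c (none, σ)) = 0 := by
  simp [estimate, inputOf]

/-- In an active block the estimate is a multiple of the sum of the rotated output letters. -/
lemma exists_estimate_some {m : ℕ} {ρ : ℝ} (hρ : 0 < ρ) (c : Bool × Bool) {n : Fin (m + 1)}
    (hn : n ≠ 0) : ∃ a : ℂ, a ≠ 0 ∧ ∀ u σ,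
    estimate ρ n (inputOf ρ c (some u, σ), outputOf c (some u, σ)) =
      a * ∑ t ∈ past n, letter (σ t) := by
  refine ⟨1 / (((n : ℕ) : ℂ) * (√ρ : ℂ)) * ((√(ρ / 2) : ℂ) * ⟨1, -1⟩), ?_, fun u σ => ?_⟩
  · have h1 : ((n : ℕ) : ℂ) ≠ 0 := by
      rw [Nat.cast_ne_zero]
      exact fun h => hn (Fin.ext h)
    have h2 : (√ρ : ℂ) ≠ 0 := by
      have : √ρ ≠ 0 := by positivity
      exact_mod_cast this
    have h3 : (⟨1, -1⟩ : ℂ) ≠ 0 := fun h => by simpa using congrArg Complex.re h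
    exact mul_ne_zero (one_div_ne_zero (mul_ne_zero h1 h2)) (mul_ne_zero (sqrt_half_ne_zero hρ) h3)
  · simp only [estimate, inputOf, outputOf, star_symbol_mul_letter_rotate]
    simp only [mul_assoc, ← Finset.mul_sum]

section Symbol

variable {m : ℕ} {ρ p : ℝ}

open Classical in
/-- The law of input, output and estimate at one time, in terms of outcomes. -/
lemma blockLaw_real_symbol (hρ : 0 < ρ) (hp : 0 ≤ p) (hp1 : p ≤ 1) (c : Bool × Bool)
    (n : Fin (m + 1)) {S : Set (ℂ × ℂ × ℂ)} (hS : MeasurableSet S) :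
    (blockLaw (onOffInput (m + 1) ρ p (symbol ρ c))).real
        {ω | (input ω n, output ω n, lsEstimate ρ n ω) ∈ S} =
      ∑ θ : Outcome m, weight ρ p θ *
        if (inputOf ρ c θ n, outputOf c θ n, estimate ρ n (inputOf ρ c θ, outputOf c θ)) ∈ S
          then 1 else 0 := by
  have hm : Measurable fun v : (Fin (m + 1) → ℂ) × (Fin (m + 1) → ℂ) =>
      (v.1 n, v.2 n, estimate ρ n v) := by fun_prop
  exact blockLaw_real hρ hp hp1 c (hm hS)

/-- The information on one symbol given the estimate: two bits minus the conditional entropy of the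
rotated output letter given all the past ones, in active blocks only. -/
lemma condMutualInfo_lsEstimate (hρ : 0 < ρ) (hp : 0 ≤ p) (hp1 : p ≤ 1) (c : Bool × Bool)
    (i : Fin m) :
    condMutualInfo (blockLaw (onOffInput (m + 1) ρ p (symbol ρ c)))
        (fun ω => input ω i.succ) (fun ω => output ω i.succ) (lsEstimate ρ i.succ) =
      p * ∑ σ : Fin (m + 1) → Bool × Bool, wordProb ρ Finset.univ σ *
        Real.logb 2 (4 * wordProb ρ (insert i.succ (past i.succ)) σ /
          wordProb ρ (past i.succ) σ) := by
  classical
  set n : Fin (m + 1) := i.succ with hn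
  set μ := blockLaw (onOffInput (m + 1) ρ p (symbol ρ c)) with hμ
  obtain ⟨a, ha, hest⟩ := exists_estimate_some (m := m) hρ c (n := n) (Fin.succ_ne_zero i)
  have hlaw := fun (S : Set (ℂ × ℂ × ℂ)) (hS : MeasurableSet S) =>
    blockLaw_real_symbol hρ hp hp1 c n hS
  have hXYZ : ∀ x y z, μ.real {ω | input ω n = x ∧ output ω n = y ∧ lsEstimate ρ n ω = z} =
      ∑ θ : Outcome m, weight ρ p θ * if inputOf ρ c θ n = x ∧ outputOf c θ n = y ∧
        estimate ρ n (inputOf ρ c θ, outputOf c θ) = z then 1 else 0 := by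
    intro x y z
    have := hlaw {v | v.1 = x ∧ v.2.1 = y ∧ v.2.2 = z}
      ((measurableSet_eq_fun (by fun_prop) measurable_const).inter
        ((measurableSet_eq_fun (by fun_prop) measurable_const).inter
          (measurableSet_eq_fun (by fun_prop) measurable_const)))
    simp only [Set.mem_ofPred_eq] at this
    convert this
  have hXZ : ∀ x z, μ.real {ω | input ω n = x ∧ lsEstimate ρ n ω = z} =
      ∑ θ : Outcome m, weight ρ p θ * if inputOf ρ c θ n = x ∧
        estimate ρ n (inputOf ρ c θ, outputOf c θ) = z then 1 else 0 := by
    intro x z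
    have := hlaw {v | v.1 = x ∧ v.2.2 = z}
      ((measurableSet_eq_fun (by fun_prop) measurable_const).inter
        (measurableSet_eq_fun (by fun_prop) measurable_const))
    simp only [Set.mem_ofPred_eq] at this
    convert this
  have hYZ : ∀ y z, μ.real {ω | output ω n = y ∧ lsEstimate ρ n ω = z} =
      ∑ θ : Outcome m, weight ρ p θ * if outputOf c θ n = y ∧
        estimate ρ n (inputOf ρ c θ, outputOf c θ) = z then 1 else 0 := by
    intro y z
    have := hlaw {v | v.2.1 = y ∧ v.2.2 = z}
      ((measurableSet_eq_fun (by fun_prop) measurable_const).inter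
        (measurableSet_eq_fun (by fun_prop) measurable_const))
    simp only [Set.mem_ofPred_eq] at this
    convert this
  have hZ : ∀ z, μ.real {ω | lsEstimate ρ n ω = z} =
      ∑ θ : Outcome m, weight ρ p θ *
        if estimate ρ n (inputOf ρ c θ, outputOf c θ) = z then 1 else 0 := by
    intro z
    have := hlaw {v | v.2.2 = z} (measurableSet_eq_fun (by fun_prop) measurable_const)
    simp only [Set.mem_ofPred_eq] at this
    convert this
  -- a letter at a fixed time is uniformly distributed over the words
  have hunif : ∀ r : Bool × Bool, 4 * ∑ σ : Fin (m + 1) → Bool × Bool,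
      (if σ n = r then (1 : ℝ) else 0) = 4 ^ (m + 1) := by
    intro r
    have := four_mul_sum_apply n fun k => if k = r then (1 : ℝ) else 0
    simpa using this
  have hunif' : ∀ k : Bool × Bool, ∑ u : Fin m → Bool × Bool,
      (if u i = k then (1 : ℝ) else 0) = 4 ^ m / 4 := by
    intro k
    have := four_mul_sum_apply i fun l => if l = k then (1 : ℝ) else 0
    simp only [Finset.sum_ite_eq', Finset.mem_univ, if_true, Fintype.card_fin, mul_one] at this
    rw [← this, mul_div_cancel_left₀ _ four_ne_zero]
  have hXsome : ∀ (u : Fin m → Bool × Bool) (σ : Fin (m + 1) → Bool × Bool),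
      inputOf ρ c (some u, σ) n = symbol ρ (u i) := fun _ _ => rfl
  have hXnone : ∀ σ : Fin (m + 1) → Bool × Bool, inputOf ρ c (none, σ) n = 0 := fun _ => rfl
  have hYsome : ∀ (u : Fin m → Bool × Bool) (σ : Fin (m + 1) → Bool × Bool),
      outputOf c (some u, σ) n = letter (rotate (u i) (σ n)) := fun _ _ => rfl
  have hYnone : ∀ σ : Fin (m + 1) → Bool × Bool, outputOf c (none, σ) n = letter (σ n) :=
    fun _ => rfl
  -- the output letter is uniform and independent of the estimate
  have hYZ' : ∀ r z, μ.real {ω | output ω n = letter r ∧ lsEstimate ρ n ω = z} =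
      μ.real {ω | lsEstimate ρ n ω = z} / 4 := by
    intro r z
    rw [hYZ, hZ, sum_outcome, sum_outcome, add_div]
    congr 1
    · simp only [estimate_none, hYnone, letter_injective.eq_iff, weight, ← Finset.mul_sum]
      rw [mul_div_assoc]
      congr 1
      by_cases h0 : (0 : ℂ) = z
      · have := hunif r
        simp only [h0, and_true, if_true, Finset.sum_const, Finset.card_univ, Fintype.card_fun,
          Fintype.card_prod, Fintype.card_bool, Fintype.card_fin]
        norm_num
        simp only [Finset.sum_boole] at this
        linarith
      · simp [h0]
    · rw [Finset.sum_comm, Finset.sum_comm (s := Finset.univ (α := Fin m → Bool × Bool)),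
        Finset.sum_div]
      refine Finset.sum_congr rfl fun σ _ => ?_
      simp only [hest, hYsome, letter_injective.eq_iff, weight, ← Finset.mul_sum]
      rw [mul_div_assoc]
      congr 1
      have hrot : ∑ k, (if rotate k (σ n) = r then (1 : ℝ) else 0) = 1 := by
        obtain ⟨k, hk⟩ := (Finite.injective_iff_surjective.1 (rotate_left_injective (σ n))) r
        rw [Finset.sum_eq_single k]
        · simp [show rotate k (σ n) = r from hk]
        · intro l _ hl
          rw [if_neg]
          intro h
          exact hl (rotate_left_injective (σ n) (h.trans hk.symm))
        · simp
      have := four_mul_sum_apply i fun k => if rotate k (σ n) = r then (1 : ℝ) else 0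
      rw [hrot] at this
      by_cases h0 : a * ∑ t ∈ past n, letter (σ t) = z
      · simp only [h0, and_true, if_true, Finset.sum_const, Finset.card_univ, Fintype.card_fun,
          Fintype.card_prod, Fintype.card_bool, Fintype.card_fin] at this ⊢
        norm_num
        simp only [Finset.sum_boole] at this
        linarith
      · simp [h0]
  rw [condMutualInfo_eq_sum (weight ρ p) (fun θ => inputOf ρ c θ n) (fun θ => outputOf c θ n)
    (fun θ => estimate ρ n (inputOf ρ c θ, outputOf c θ)) (by
      intro x y z
      rw [hXYZ]), sum_outcome]
  -- silent blocks carry no information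
  have hsilent : ∀ σ₀ : Fin (m + 1) → Bool × Bool,
      weight ρ p (none, σ₀) * Real.logb 2
        (μ.real {ω | lsEstimate ρ n ω =
            estimate ρ n (inputOf ρ c (none, σ₀), outputOf c (none, σ₀))} *
          μ.real {ω | input ω n = inputOf ρ c (none, σ₀) n ∧
            output ω n = outputOf c (none, σ₀) n ∧ lsEstimate ρ n ω =
              estimate ρ n (inputOf ρ c (none, σ₀), outputOf c (none, σ₀))} /
        (μ.real {ω | input ω n = inputOf ρ c (none, σ₀) n ∧ lsEstimate ρ n ω =
            estimate ρ n (inputOf ρ c (none, σ₀), outputOf c (none, σ₀))} *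
          μ.real {ω | output ω n = outputOf c (none, σ₀) n ∧ lsEstimate ρ n ω =
            estimate ρ n (inputOf ρ c (none, σ₀), outputOf c (none, σ₀))})) = 0 := by
    intro σ₀
    rw [estimate_none, hXnone, hYnone, hYZ']
    have h1 : μ.real {ω | input ω n = 0 ∧ lsEstimate ρ n ω = 0} = 1 - p := by
      rw [hXZ, sum_outcome]
      simp only [hXnone, hXsome, estimate_none, symbol_ne_zero hρ, weight]
      simp
      field_simp
    have h2 : μ.real {ω | input ω n = 0 ∧ output ω n = letter (σ₀ n) ∧ lsEstimate ρ n ω = 0} =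
        (1 - p) / 4 := by
      have := hunif (σ₀ n)
      rw [hXYZ, sum_outcome]
      simp only [hXnone, hXsome, hYnone, estimate_none, symbol_ne_zero hρ, weight,
        letter_injective.eq_iff, false_and, true_and, and_true, if_false, mul_zero,
        Finset.sum_const_zero, add_zero, ← Finset.mul_sum]
      rw [div_mul_eq_mul_div, div_eq_div_iff (by positivity) (by norm_num)]
      linear_combination (1 - p) * this
    rw [h1, h2]
    set P := μ.real {ω | lsEstimate ρ n ω = 0}
    rcases eq_or_ne (P * ((1 - p) / 4)) 0 with h0 | h0
    · simp [h0]
    · rw [show (1 - p) * (P / 4) = P * ((1 - p) / 4) by ring, div_self h0]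
      simp
  -- in active blocks the estimate is as good as all the past letters
  have hactive : ∀ (u₀ : Fin m → Bool × Bool) (σ₀ : Fin (m + 1) → Bool × Bool), 0 < p →
      μ.real {ω | lsEstimate ρ n ω =
            estimate ρ n (inputOf ρ c (some u₀, σ₀), outputOf c (some u₀, σ₀))} *
          μ.real {ω | input ω n = inputOf ρ c (some u₀, σ₀) n ∧
            output ω n = outputOf c (some u₀, σ₀) n ∧ lsEstimate ρ n ω =
              estimate ρ n (inputOf ρ c (some u₀, σ₀), outputOf c (some u₀, σ₀))} /
        (μ.real {ω | input ω n = inputOf ρ c (some u₀, σ₀) n ∧ lsEstimate ρ n ω =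
            estimate ρ n (inputOf ρ c (some u₀, σ₀), outputOf c (some u₀, σ₀))} *
          μ.real {ω | output ω n = outputOf c (some u₀, σ₀) n ∧ lsEstimate ρ n ω =
            estimate ρ n (inputOf ρ c (some u₀, σ₀), outputOf c (some u₀, σ₀))}) =
      4 * wordProb ρ (insert n (past n)) σ₀ / wordProb ρ (past n) σ₀ := by
    intro u₀ σ₀ hp0
    have hsuff := sum_mul_wordProb_eq ρ (notMem_past n) σ₀
    set F := ∑ σ, (if σ n = σ₀ n ∧ ∑ t ∈ past n, letter (σ t) = ∑ t ∈ past n, letter (σ₀ t)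
      then 1 else 0) * wordProb ρ Finset.univ σ with hF
    set f := ∑ σ, (if ∑ t ∈ past n, letter (σ t) = ∑ t ∈ past n, letter (σ₀ t)
      then 1 else 0) * wordProb ρ Finset.univ σ with hf
    have hf0 : 0 < f := by
      refine Finset.sum_pos' (fun σ _ => mul_nonneg (by split_ifs <;> norm_num)
        (wordProb_pos ρ _ σ).le) ⟨σ₀, Finset.mem_univ _, ?_⟩
      rw [if_pos rfl, one_mul]
      exact wordProb_pos ρ _ σ₀
    rw [hest, hXsome, hYsome, hYZ']
    have hu := hunif' (u₀ i)
    have h1 : μ.real {ω | input ω n = symbol ρ (u₀ i) ∧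
        lsEstimate ρ n ω = a * ∑ t ∈ past n, letter (σ₀ t)} = p / 4 * f := by
      rw [hXZ, sum_outcome]
      simp only [hXnone, hXsome, hest, (symbol_ne_zero hρ _).symm, (symbol_injective hρ).eq_iff,
        mul_right_inj' ha, weight, false_and, if_false, mul_zero, Finset.sum_const_zero, zero_add]
      have hsplit : ∀ (u : Fin m → Bool × Bool) (σ : Fin (m + 1) → Bool × Bool),
          p / 4 ^ m * wordProb ρ Finset.univ σ * (if u i = u₀ i ∧
            ∑ t ∈ past n, letter (σ t) = ∑ t ∈ past n, letter (σ₀ t) then 1 else 0) =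
          p / 4 ^ m * (if u i = u₀ i then 1 else 0) *
            ((if ∑ t ∈ past n, letter (σ t) = ∑ t ∈ past n, letter (σ₀ t) then 1 else 0) *
              wordProb ρ Finset.univ σ) := by
        intro u σ
        by_cases h1 : u i = u₀ i <;>
          by_cases h2 : ∑ t ∈ past n, letter (σ t) = ∑ t ∈ past n, letter (σ₀ t) <;>
          simp [h1, h2]
      simp only [hsplit, ← Finset.mul_sum, ← Finset.sum_mul]
      rw [← hf, hu]
      field_simp
    have h2 : μ.real {ω | input ω n = symbol ρ (u₀ i) ∧
        output ω n = letter (rotate (u₀ i) (σ₀ n)) ∧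
        lsEstimate ρ n ω = a * ∑ t ∈ past n, letter (σ₀ t)} = p / 4 * F := by
      rw [hXYZ, sum_outcome]
      simp only [hXnone, hXsome, hYsome, hest, (symbol_ne_zero hρ _).symm,
        (symbol_injective hρ).eq_iff, letter_injective.eq_iff,
        mul_right_inj' ha, weight, false_and, if_false, mul_zero, Finset.sum_const_zero, zero_add]
      have hsplit : ∀ (u : Fin m → Bool × Bool) (σ : Fin (m + 1) → Bool × Bool),
          p / 4 ^ m * wordProb ρ Finset.univ σ * (if u i = u₀ i ∧
            rotate (u i) (σ n) = rotate (u₀ i) (σ₀ n) ∧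
            ∑ t ∈ past n, letter (σ t) = ∑ t ∈ past n, letter (σ₀ t) then 1 else 0) =
          p / 4 ^ m * (if u i = u₀ i then 1 else 0) *
            ((if σ n = σ₀ n ∧ ∑ t ∈ past n, letter (σ t) = ∑ t ∈ past n, letter (σ₀ t)
              then 1 else 0) * wordProb ρ Finset.univ σ) := by
        intro u σ
        by_cases h1 : u i = u₀ i
        · by_cases h2 : ∑ t ∈ past n, letter (σ t) = ∑ t ∈ past n, letter (σ₀ t) <;>
            by_cases h3 : σ n = σ₀ n <;> simp [h1, h2, h3, (rotate_injective (u₀ i)).eq_iff]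
        · simp [h1]
      simp only [hsplit, ← Finset.mul_sum, ← Finset.sum_mul]
      rw [← hF, hu]
      field_simp
    have h3 : 0 < μ.real {ω | lsEstimate ρ n ω = a * ∑ t ∈ past n, letter (σ₀ t)} := by
      refine lt_of_lt_of_le (show 0 < p / 4 * f by positivity) (h1 ▸ ?_)
      have : IsFiniteMeasure μ := by
        rw [hμ, blockLaw, onOffInput_eq hρ]
        have : IsFiniteMeasure (((4 : ENNReal) ^ m)⁻¹ • ∑ u : Fin m → Bool × Bool,
            Measure.dirac fun t => symbol ρ (activeBits c u t)) := Measure.smul_finite _ (by simp)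
        have := Measure.smul_finite (((4 : ENNReal) ^ m)⁻¹ • ∑ u : Fin m → Bool × Bool,
            Measure.dirac fun t => symbol ρ (activeBits c u t)) (ENNReal.ofReal_ne_top (r := p))
        have := Measure.smul_finite (Measure.dirac (0 : Fin (m + 1) → ℂ))
          (ENNReal.ofReal_ne_top (r := 1 - p))
        infer_instance
      exact measureReal_mono fun ω h => h.2
    rw [h1, h2]
    have hA := wordProb_pos ρ (past n) σ₀
    rw [div_eq_div_iff (by positivity) hA.ne']
    linear_combination (p * μ.real {ω | lsEstimate ρ n ω =
      a * ∑ t ∈ past n, letter (σ₀ t)}) / 4 * hsuff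
  simp only [hsilent, Finset.sum_const_zero, zero_add]
  rcases hp.eq_or_lt with h0 | hp0
  · simp [weight, ← h0]
  · simp only [hactive _ _ hp0, weight, Finset.sum_const, Finset.card_univ, Fintype.card_fun,
      Fintype.card_prod, Fintype.card_bool, Fintype.card_fin, nsmul_eq_mul, Finset.mul_sum]
    refine Finset.sum_congr rfl fun σ _ => ?_
    push_cast
    field_simp

end Symbol

/-! ### The rate of the scheme -/

section Rate

variable {m : ℕ} {ρ p : ℝ}

/-- Each symbol contributes two bits minus the conditional entropy of the rotated output letter
given the past ones; by the chain rule these conditional entropies add up to the entropy of the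
whole output word. -/
lemma jpdRate_eq (hρ : 0 < ρ) (hp : 0 ≤ p) (hp1 : p ≤ 1) (c : Bool × Bool) :
    jpdRate (m + 1) ρ p (symbol ρ c) = p * rateQPSK (m + 1) ρ := by
  set P : ℕ → Finset (Fin (m + 1)) := fun k => Finset.univ.filter fun t => (t : ℕ) < k with hP
  have hpast : ∀ i : Fin m, past i.succ = P (i + 1) := by
    intro i
    ext t
    simp [past, hP, Fin.lt_def]
  have hinsert : ∀ i : Fin m, insert i.succ (past i.succ) = P (i + 2) := by
    intro i
    ext t
    simp only [past, hP, Finset.mem_insert, Finset.mem_filter, Finset.mem_univ, true_and,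
      Fin.lt_def, Fin.ext_iff, Fin.val_succ]
    omega
  have hP1 : P 1 = {0} := by
    ext t
    simp only [hP, Finset.mem_filter, Finset.mem_univ, true_and, Finset.mem_singleton, Fin.ext_iff,
      Fin.val_zero]
    omega
  have hPT : P (m + 1) = Finset.univ := by
    ext t
    simp only [hP, Finset.mem_filter, Finset.mem_univ, true_and, t.is_lt]
  have htel : ∀ σ : Fin (m + 1) → Bool × Bool,
      ∑ i : Fin m, Real.logb 2 (4 * wordProb ρ (insert i.succ (past i.succ)) σ /
        wordProb ρ (past i.succ) σ) =
      2 * (m + 1 : ℝ) + Real.logb 2 (wordProb ρ Finset.univ σ) := by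
    intro σ
    have h4 : Real.logb 2 4 = 2 := by
      rw [show (4 : ℝ) = 2 ^ 2 by norm_num, Real.logb_pow, Real.logb_self_eq_one (by norm_num)]
      norm_num
    have h : ∀ i : Fin m, Real.logb 2 (4 * wordProb ρ (insert i.succ (past i.succ)) σ /
        wordProb ρ (past i.succ) σ) = 2 + (Real.logb 2 (wordProb ρ (P ((i : ℕ) + 1 + 1)) σ) -
          Real.logb 2 (wordProb ρ (P ((i : ℕ) + 1)) σ)) := by
      intro i
      have h1 := wordProb_pos ρ (insert i.succ (past i.succ)) σ
      have h2 := wordProb_pos ρ (past i.succ) σ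
      rw [Real.logb_div (by positivity) h2.ne', Real.logb_mul (by norm_num) h1.ne', h4, hinsert,
        hpast]
      ring
    simp only [h, Finset.sum_add_distrib]
    rw [Fin.sum_univ_eq_sum_range (fun i => Real.logb 2 (wordProb ρ (P (i + 1 + 1)) σ) -
      Real.logb 2 (wordProb ρ (P (i + 1)) σ)),
      Finset.sum_range_sub fun i => Real.logb 2 (wordProb ρ (P (i + 1)) σ), hPT, zero_add, hP1,
      wordProb_singleton, one_div, Real.logb_inv, h4]
    simp
    ring
  have hsum : ∑ n ∈ Finset.univ.filter (fun n : Fin (m + 1) => 1 ≤ (n : ℕ)),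
      condMutualInfo (blockLaw (onOffInput (m + 1) ρ p (symbol ρ c)))
        (fun ω => input ω n) (fun ω => output ω n) (lsEstimate ρ n) =
      ∑ i : Fin m, condMutualInfo (blockLaw (onOffInput (m + 1) ρ p (symbol ρ c)))
        (fun ω => input ω i.succ) (fun ω => output ω i.succ) (lsEstimate ρ i.succ) := by
    rw [Finset.sum_filter, Fin.sum_univ_succ]
    simp
  rw [jpdRate, hsum]
  simp only [condMutualInfo_lsEstimate hρ hp hp1]
  rw [← Finset.mul_sum, Finset.sum_comm]
  simp only [← Finset.mul_sum, htel, mul_add, Finset.sum_add_distrib, ← Finset.sum_mul,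
    sum_wordProb, sum_wordProb_mul_logb, Fintype.card_fin]
  rw [rateQPSK]
  push_cast
  field_simp

/-- The output word is uniformly distributed, whatever the duty cycle. -/
lemma blockLaw_real_output_eq (hρ : 0 < ρ) (hp : 0 ≤ p) (hp1 : p ≤ 1) (c : Bool × Bool)
    (τ : Fin (m + 1) → Bool × Bool) :
    (blockLaw (onOffInput (m + 1) ρ p (symbol ρ c))).real
      {ω | output ω = fun t => letter (τ t)} = 1 / 4 ^ (m + 1) := by
  classical
  have h := blockLaw_real (m := m) hρ hp hp1 c (A := {v | v.2 = fun t => letter (τ t)})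
    (measurableSet_eq_fun measurable_snd measurable_const)
  simp only [Set.mem_ofPred_eq] at h
  rw [h, sum_outcome]
  have hinj : Function.Injective fun (τ : Fin (m + 1) → Bool × Bool) t => letter (τ t) :=
    letter_injective.comp_left
  have hnone : ∀ σ, (outputOf c ((none, σ) : Outcome m) = fun t => letter (τ t)) ↔ σ = τ :=
    fun σ => hinj.eq_iff
  obtain ⟨s, hs⟩ := (Finite.injective_iff_surjective.1 (rotate_injective c)) (τ 0)
  -- for every rotated output word exactly one choice of the data symbols leads to `τ`
  have hsome : ∀ σ, ∑ u : Fin m → Bool × Bool,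
      (if outputOf c ((some u, σ) : Outcome m) = fun t => letter (τ t) then (1 : ℝ) else 0) =
        if σ 0 = s then 1 else 0 := by
    intro σ
    choose k hk using fun i : Fin m =>
      (Finite.injective_iff_surjective.1 (rotate_left_injective (σ i.succ))) (τ i.succ)
    have hiff : ∀ u : Fin m → Bool × Bool,
        (outputOf c ((some u, σ) : Outcome m) = fun t => letter (τ t)) ↔ u = k ∧ σ 0 = s := by
      intro u
      rw [show outputOf c ((some u, σ) : Outcome m) =
        fun t => letter (rotate (activeBits c u t) (σ t)) from rfl,
        hinj.eq_iff (a := fun t => rotate (activeBits c u t) (σ t)), funext_iff,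
        Fin.forall_fin_succ, activeBits_zero, ← hs, (rotate_injective c).eq_iff, and_comm,
        funext_iff]
      refine and_congr_left fun _ => forall_congr' fun i => ?_
      rw [activeBits_succ, ← hk i]
      exact (rotate_left_injective (σ i.succ)).eq_iff
    simp only [hiff]
    by_cases h0 : σ 0 = s <;> simp [h0]
  have h1 : ∑ σ : Fin (m + 1) → Bool × Bool, weight ρ p ((none, σ) : Outcome m) *
      (if outputOf c ((none, σ) : Outcome m) = fun t => letter (τ t) then 1 else 0) =
      (1 - p) / 4 ^ (m + 1) := by
    simp only [hnone]
    simp [weight]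
  have h2 : ∑ u : Fin m → Bool × Bool, ∑ σ, weight ρ p ((some u, σ) : Outcome m) *
      (if outputOf c ((some u, σ) : Outcome m) = fun t => letter (τ t) then 1 else 0) =
      p / 4 ^ (m + 1) := by
    rw [Finset.sum_comm]
    simp only [weight, ← Finset.mul_sum, hsome]
    have := sum_ite_wordProb ρ (0 : Fin (m + 1)) s
    simp only [mul_assoc, ← Finset.mul_sum]
    simp only [mul_comm (wordProb ρ Finset.univ _), this]
    field_simp
    ring
  rw [show (1 : ℝ) / 4 ^ (m + 1) = (1 - p) / 4 ^ (m + 1) + p / 4 ^ (m + 1) by ring, ← h1, ← h2]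
  congr!

/-- The mutual information between the whole input and output words equals the sum of the rates
of the symbols: decoding with the least-squares estimates loses nothing. -/
lemma mutualInfo_eq (hρ : 0 < ρ) (hp : 0 ≤ p) (hp1 : p ≤ 1) (c : Bool × Bool) :
    mutualInfo (blockLaw (onOffInput (m + 1) ρ p (symbol ρ c))) input output =
      ((m + 1 : ℕ) : ℝ) * (p * rateQPSK (m + 1) ρ) := by
  classical
  set μ := blockLaw (onOffInput (m + 1) ρ p (symbol ρ c)) with hμ
  have hXY : ∀ x y, μ.real {ω | input ω = x ∧ output ω = y} =
      ∑ θ : Outcome m, weight ρ p θ * if inputOf ρ c θ = x ∧ outputOf c θ = y then 1 else 0 := by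
    intro x y
    have := blockLaw_real (m := m) hρ hp hp1 c (A := {v | v.1 = x ∧ v.2 = y})
      ((measurableSet_eq_fun measurable_fst measurable_const).inter
        (measurableSet_eq_fun measurable_snd measurable_const))
    simp only [Set.mem_ofPred_eq] at this
    convert this
  have hX : ∀ x, μ.real {ω | input ω = x} =
      ∑ θ : Outcome m, weight ρ p θ * if inputOf ρ c θ = x then 1 else 0 := by
    intro x
    have := blockLaw_real (m := m) hρ hp hp1 c (A := {v | v.1 = x})
      (measurableSet_eq_fun measurable_fst measurable_const)
    simp only [Set.mem_ofPred_eq] at this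
    convert this
  have hinj : Function.Injective fun (τ : Fin (m + 1) → Bool × Bool) t => letter (τ t) :=
    letter_injective.comp_left
  have hne : ∀ (u : Fin m → Bool × Bool),
      (fun t => symbol ρ (activeBits c u t)) ≠ (0 : Fin (m + 1) → ℂ) := fun u h =>
    symbol_ne_zero hρ _ (congrFun h 0)
  have hXnone : ∀ σ : Fin (m + 1) → Bool × Bool, inputOf ρ c (none, σ) = 0 := fun _ => rfl
  have hXsome : ∀ (u : Fin m → Bool × Bool) (σ : Fin (m + 1) → Bool × Bool),
      inputOf ρ c (some u, σ) = fun t => symbol ρ (activeBits c u t) := fun _ _ => rfl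
  rw [mutualInfo_eq_sum (weight ρ p) (inputOf ρ c) (outputOf c) (by
    intro x y
    rw [hXY]
    congr!), sum_outcome]
  have hnone : ∀ σ₀ : Fin (m + 1) → Bool × Bool, weight ρ p ((none, σ₀) : Outcome m) *
      Real.logb 2 (μ.real {ω | input ω = inputOf ρ c (none, σ₀) ∧
        output ω = outputOf c (none, σ₀)} / (μ.real {ω | input ω = inputOf ρ c (none, σ₀)} *
          μ.real {ω | output ω = outputOf c (none, σ₀)})) = 0 := by
    intro σ₀
    have h1 : μ.real {ω | input ω = inputOf ρ c (none, σ₀)} = 1 - p := by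
      rw [hX, sum_outcome]
      simp [hXnone, hXsome, hne, weight]
      field_simp
    have h2 : μ.real {ω | input ω = inputOf ρ c (none, σ₀) ∧ output ω = outputOf c (none, σ₀)} =
        (1 - p) / 4 ^ (m + 1) := by
      have hY : ∀ σ, (outputOf c ((none, σ) : Outcome m) = outputOf c (none, σ₀)) ↔ σ = σ₀ :=
        fun σ => hinj.eq_iff
      rw [hXY, sum_outcome]
      simp [hXnone, hXsome, hne, weight, hY]
    have h3 : μ.real {ω | output ω = outputOf c (none, σ₀)} = 1 / 4 ^ (m + 1) :=
      blockLaw_real_output_eq hρ hp hp1 c σ₀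
    rw [h1, h2, h3, mul_one_div]
    rcases eq_or_ne ((1 - p) / 4 ^ (m + 1)) 0 with h0 | h0
    · simp [h0]
    · rw [div_self h0]
      simp
  have hsome : ∀ (u₀ : Fin m → Bool × Bool) (σ₀ : Fin (m + 1) → Bool × Bool), 0 < p →
      μ.real {ω | input ω = inputOf ρ c (some u₀, σ₀) ∧ output ω = outputOf c (some u₀, σ₀)} /
        (μ.real {ω | input ω = inputOf ρ c (some u₀, σ₀)} *
          μ.real {ω | output ω = outputOf c (some u₀, σ₀)}) =
      4 ^ (m + 1) * wordProb ρ Finset.univ σ₀ := by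
    intro u₀ σ₀ hp0
    have hXeq : ∀ u σ, (inputOf ρ c ((some u, σ) : Outcome m) = inputOf ρ c (some u₀, σ₀)) ↔
        u = u₀ := fun u σ => (activeWord_injective hρ c).eq_iff
    have hXne : ∀ σ, inputOf ρ c ((none, σ) : Outcome m) ≠ inputOf ρ c (some u₀, σ₀) :=
      fun σ => (hne u₀).symm
    have hYeq : ∀ σ, (outputOf c ((some u₀, σ) : Outcome m) = outputOf c (some u₀, σ₀)) ↔
        σ = σ₀ := by
      refine fun σ => (hinj.eq_iff (a := fun t => rotate (activeBits c u₀ t) (σ t))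
        (b := fun t => rotate (activeBits c u₀ t) (σ₀ t))).trans ?_
      simp only [funext_iff, (rotate_injective _).eq_iff]
    have h1 : μ.real {ω | input ω = inputOf ρ c (some u₀, σ₀)} = p / 4 ^ m := by
      rw [hX, sum_outcome]
      simp only [hXeq, hXne, weight, if_false, mul_zero, Finset.sum_const_zero, zero_add]
      rw [Finset.sum_comm]
      simp [← Finset.mul_sum, sum_wordProb]
    have h2 : μ.real {ω | input ω = inputOf ρ c (some u₀, σ₀) ∧
        output ω = outputOf c (some u₀, σ₀)} = p / 4 ^ m * wordProb ρ Finset.univ σ₀ := by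
      rw [hXY, sum_outcome, Finset.sum_eq_zero, zero_add,
        Finset.sum_eq_single u₀, Finset.sum_eq_single σ₀]
      · simp [weight]
      · intro σ _ h
        simp [hYeq, h]
      · simp
      · intro u _ h
        simp [hXeq, h]
      · simp
      · intro σ _
        simp [hXne]
    have h3 : μ.real {ω | output ω = outputOf c (some u₀, σ₀)} = 1 / 4 ^ (m + 1) :=
      blockLaw_real_output_eq hρ hp hp1 c fun t => rotate (activeBits c u₀ t) (σ₀ t)
    rw [h1, h2, h3]
    field_simp
  simp only [hnone, Finset.sum_const_zero, zero_add]
  rcases hp.eq_or_lt with h0 | hp0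
  · simp [weight, ← h0]
  have hlog : ∀ σ : Fin (m + 1) → Bool × Bool, Real.logb 2 (4 ^ (m + 1) *
      wordProb ρ Finset.univ σ) = 2 * (m + 1 : ℝ) + Real.logb 2 (wordProb ρ Finset.univ σ) := by
    intro σ
    rw [Real.logb_mul (by positivity) (wordProb_pos _ _ _).ne', Real.logb_pow,
      show (4 : ℝ) = 2 ^ 2 by norm_num, Real.logb_pow, Real.logb_self_eq_one (by norm_num)]
    push_cast
    ring
  simp only [hsome _ _ hp0, weight, mul_assoc, ← Finset.mul_sum, hlog, mul_add,
    Finset.sum_add_distrib, ← Finset.sum_mul, sum_wordProb, sum_wordProb_mul_logb,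
    Fintype.card_fin, Finset.sum_const, Finset.card_univ, Fintype.card_fun, Fintype.card_prod,
    Fintype.card_bool, nsmul_eq_mul]
  rw [rateQPSK]
  push_cast
  field_simp

lemma integral_power (hρ : 0 < ρ) (hp : 0 ≤ p) (c : Bool × Bool) :
    ∫ x, ∑ t, ‖x t‖ ^ 2 ∂(onOffInput (m + 1) ρ p (symbol ρ c)) =
      ((m + 1 : ℕ) : ℝ) * (p * ρ) := by
  have hint : ∀ x : Fin (m + 1) → ℂ, Integrable (fun x : Fin (m + 1) → ℂ => ∑ t, ‖x t‖ ^ 2)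
      (Measure.dirac x) := fun x => integrable_dirac (by simp)
  have hsum : Integrable (fun x : Fin (m + 1) → ℂ => ∑ t, ‖x t‖ ^ 2)
      (∑ u : Fin m → Bool × Bool, Measure.dirac fun t => symbol ρ (activeBits c u t)) :=
    integrable_finsetSum_measure.2 fun u _ => hint _
  rw [onOffInput_eq hρ, integral_add_measure ((hint _).smul_measure ENNReal.ofReal_ne_top)
    ((hsum.smul_measure (by simp)).smul_measure ENNReal.ofReal_ne_top), integral_smul_measure,
    integral_smul_measure, integral_smul_measure, integral_finsetSum_measure fun u _ => hint _]
  simp [norm_symbol_sq hρ, ENNReal.toReal_ofReal hp]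
  field_simp

end Rate

end OneBit

theorem theorem2 (T : ℕ) (hT : 1 ≤ T) :
    -- plain QPSK signalling: the scheme attains the QPSK rate at every power
    (∀ ρ : ℝ, 0 < ρ → ∀ pilot ∈ OneBit.qpsk ρ,
      OneBit.jpdRate T ρ 1 pilot = OneBit.rateQPSK T ρ) ∧
    -- the threshold in the capacity formula exists
    (∃ ρc : ℝ, OneBit.IsSNRThreshold T ρc) ∧
    -- the scheme satisfies the power constraint, its rate is achievable over the channel,
    -- and its rate is the capacity
    (∀ ρc : ℝ, OneBit.IsSNRThreshold T ρc → ∀ snr : ℝ, 0 ≤ snr →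
      ∀ pilot ∈ OneBit.qpsk (OneBit.activePower ρc snr),
        (∫ x, ∑ t, ‖x t‖ ^ 2 ∂(OneBit.onOffInput T (OneBit.activePower ρc snr)
            (OneBit.dutyCycle ρc snr) pilot)) = T * snr ∧
        OneBit.jpdRate T (OneBit.activePower ρc snr) (OneBit.dutyCycle ρc snr) pilot ≤
          1 / (T : ℝ) * OneBit.mutualInfo
            (OneBit.blockLaw (OneBit.onOffInput T (OneBit.activePower ρc snr)
              (OneBit.dutyCycle ρc snr) pilot)) OneBit.input OneBit.output ∧
        OneBit.jpdRate T (OneBit.activePower ρc snr) (OneBit.dutyCycle ρc snr) pilot =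
          OneBit.capacity T ρc snr) := by
  refine ⟨?_, OneBit.exists_isSNRThreshold hT, ?_⟩
  all_goals obtain ⟨m, rfl⟩ : ∃ m, T = m + 1 := ⟨T - 1, by omega⟩
  · intro ρ hρ pilot hpilot
    obtain ⟨c, rfl⟩ := OneBit.exists_mem_qpsk.1 hpilot
    rw [OneBit.jpdRate_eq hρ zero_le_one le_rfl, one_mul]
  · intro ρc hρc snr hsnr pilot hpilot
    obtain ⟨c, rfl⟩ := OneBit.exists_mem_qpsk.1 hpilot
    have hc : 0 < ρc := hρc.1
    have hρ : 0 < OneBit.activePower ρc snr := by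
      rw [OneBit.activePower]
      split_ifs with h
      · exact hc
      · exact hc.trans (not_le.1 h)
    have hp : 0 ≤ OneBit.dutyCycle ρc snr := by
      rw [OneBit.dutyCycle]
      split_ifs <;> positivity
    have hp1 : OneBit.dutyCycle ρc snr ≤ 1 := by
      rw [OneBit.dutyCycle]
      split_ifs with h
      · exact (div_le_one hc).2 h
      · exact le_rfl
    rw [OneBit.integral_power hρ hp, OneBit.jpdRate_eq hρ hp hp1, OneBit.mutualInfo_eq hρ hp hp1]
    refine ⟨?_, le_of_eq ?_, ?_⟩
    · rw [OneBit.activePower, OneBit.dutyCycle]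
      split_ifs
      · rw [div_mul_cancel₀ _ hc.ne']
      · rw [one_mul]
    · field_simp
    · rw [OneBit.activePower, OneBit.dutyCycle, OneBit.capacity]
      split_ifs
      · rfl
      · rw [one_mul]
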